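/- Let $\mathbb{H}=\{z\in\mathbb{C}:\operatorname{Im} z>0\}$. For a continuous function $\lambda:[0,\infty)\to\mathbb{R}$ and $z\in\mathbb{H}$ let $g_t(z)$ be the solution of the chordal Loewner equation $$\frac{\partial}{\partial t}g_t(z)=\frac{2}{g_t(z)-\lambda(t)},\qquad g_0(z)=z,$$ let $T_z$ be the supremum of all $s\ge 0$ such that $g_t(z)$ exists on $[0,s)$, and let $K_t=\{z\in\mathbb{H}:T_z\le t\}$ be the hulls driven by $\lambda$. A trace driven by $\lambda$ is a continuous path $\gamma:[0,\infty)\to\overline{\mathbb{H}}$ such that, for every $t\ge 0$, $K_t$ is the complement in $\mathbb{H}$ of the unbounded component of $\mathbb{H}\setminus\gamma[0,t]$. The Lip$(1/2)$ norm $\|\lambda\|_{1/2}$ is the smallest $C$ such that $|\lambda(t)-\lambda(s)|\le C|t-s|^{1/2}$ for all $s,t\ge 0$. **Proposition.** For every sequence $z_1,z_2,z_3,\dots$ of distinct points in $\mathbb{H}$ there are a function $\lambda:[0,\infty)\to\mathbb{R}$ with $\|\lambda\|_{1/2}\le 4$ and a trace $\gamma$ driven by $\lambda$ that visits these points in this order: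 there are times $0\le t_1<t_2<t_3<\cdots$ such that, for every $n$, $\gamma(t_n)=z_n$ and $\gamma(s)\ne z_n$ for $0\le s<t_n$. -/

import Mathlib

open scoped NNReal ENNReal

noncomputable section

namespace Loewner

/-- The Lip(1/2) norm of a driving function `lam` on its domain `[0, ∞)`: the smallest `C` such that
`|lam t - lam s| ≤ C * |t - s| ^ (1/2)` for all `s, t ≥ 0` (it is `∞` if there is no such `C`).
The values of `lam` at negative times play no role. -/
def lipHalfNorm (lam : ℝ → ℝ) : ℝ≥0∞ :=
  eHolderNorm (1 / 2) (fun t : ℝ≥0 => lam t)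

/-- `g` solves the chordal Loewner equation driven by `lam` on `[0, T)` with initial value `z`:
`g 0 = z` and `∂ₜ g = 2 / (g - lam)`, the denominator being nonzero on `[0, T)`
(the derivative is one-sided at `t = 0`). -/
structure IsSolution (lam : ℝ → ℝ) (z : ℂ) (T : ℝ) (g : ℝ → ℂ) : Prop where
  initial : g 0 = z
  ne_driving : ∀ t ∈ Set.Ico 0 T, g t ≠ (lam t : ℂ)
  hasDeriv : ∀ t ∈ Set.Ico 0 T,
    HasDerivWithinAt g (2 / (g t - (lam t : ℂ))) (Set.Ico 0 T) t

/-- The lifetime `T_z` of `z`: the supremum of all `T ≥ 0` such that the Loewner equation driven by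
`lam` and started at `z` has a solution on `[0, T)`. -/
def lifetime (lam : ℝ → ℝ) (z : ℂ) : ℝ≥0∞ :=
  ⨆ (T : ℝ≥0) (_ : ∃ g : ℝ → ℂ, IsSolution lam z T g), (T : ℝ≥0∞)

/-- The hull `K_t` generated by `lam`: the points `z` of the upper half-plane with `T_z ≤ t`. -/
def hull (lam : ℝ → ℝ) (t : ℝ) : Set ℂ :=
  {z | 0 < z.im ∧ lifetime lam z ≤ ENNReal.ofReal t}

/-- The set `A` filled in: the complement, in the upper half-plane `H`, of the unbounded component
of `H \ A`. That is, the points of `H` which lie in `A` or in a bounded component of `H \ A`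
(`connectedComponentIn F z` is empty, hence bounded, for `z ∉ F`). -/
def filling (A : Set ℂ) : Set ℂ :=
  {z | 0 < z.im ∧ Bornology.IsBounded (connectedComponentIn ({w : ℂ | 0 < w.im} \ A) z)}

/-- `γ` is the trace generated by the driving function `lam`: a continuous path
`γ : [0, ∞) → closure of H` such that, for every `t ≥ 0`, the hull `K_t` generated by `lam` is the
curve `γ[0, t]` filled in. The values of `γ` at negative times play no role. -/
structure IsTrace (lam : ℝ → ℝ) (γ : ℝ → ℂ) : Prop where
  driving_continuousOn : ContinuousOn lam (Set.Ici 0)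
  continuousOn : ContinuousOn γ (Set.Ici 0)
  im_nonneg : ∀ t, 0 ≤ t → 0 ≤ (γ t).im
  hull_eq : ∀ t, 0 ≤ t → hull lam t = filling (γ '' Set.Icc 0 t)

end Loewner

end

namespace Loewner

open Set Filter Topology Metric

/-! ### Calculus on intervals -/

theorem HasDerivWithinAt.Ici_of_Icc {E : Type*} [NormedAddCommGroup E] [NormedSpace ℝ E]
    {f : ℝ → E} {f' : E} {a b t : ℝ} (h : HasDerivWithinAt f f' (Icc a b) t)
    (ht : t ∈ Ico a b) : HasDerivWithinAt f f' (Ici t) t :=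
  h.mono_of_mem_nhdsWithin (Icc_mem_nhdsGE_of_mem ht)

theorem HasDerivWithinAt.comp_sub_Icc {E : Type*} [NormedAddCommGroup E] [NormedSpace ℝ E]
    {f : ℝ → E} {f' : E} {a b c s : ℝ} (h : HasDerivWithinAt f f' (Icc a b) (c - s)) :
    HasDerivWithinAt (fun s => f (c - s)) (-f') (Icc (c - b) (c - a)) s := by
  have h1 : HasDerivWithinAt (fun s : ℝ => c - s) (-1) (Icc (c - b) (c - a)) s := by
    simpa using (hasDerivWithinAt_id s _).const_sub c
  have h2 := HasDerivWithinAt.scomp s h h1 (fun x hx => ⟨by linarith [hx.2], by linarith [hx.1]⟩)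
  simpa using! h2

theorem norm_le_of_norm_deriv_le_mul {f f' : ℝ → ℂ} {K a b : ℝ} (hab : a ≤ b)
    (hf : ∀ t ∈ Icc a b, HasDerivWithinAt f (f' t) (Icc a b) t)
    (hK : ∀ t ∈ Icc a b, ‖f' t‖ ≤ K * ‖f t‖) :
    ‖f b‖ ≤ ‖f a‖ * Real.exp (K * (b - a)) := by
  have h := norm_le_gronwallBound_of_norm_deriv_right_le (δ := ‖f a‖) (K := K) (ε := 0)
    (fun t ht => (hf t ht).continuousWithinAt)
    (fun t ht => HasDerivWithinAt.Ici_of_Icc (hf t (Ico_subset_Icc_self ht)) ht) le_rfl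
    (fun t ht => by simpa using hK t (Ico_subset_Icc_self ht)) b (right_mem_Icc.2 hab)
  simpa [gronwallBound_ε0] using h

theorem norm_le_of_norm_deriv_le_mul_left {f f' : ℝ → ℂ} {K a b : ℝ} (hab : a ≤ b)
    (hf : ∀ t ∈ Icc a b, HasDerivWithinAt f (f' t) (Icc a b) t)
    (hK : ∀ t ∈ Icc a b, ‖f' t‖ ≤ K * ‖f t‖) :
    ‖f a‖ ≤ ‖f b‖ * Real.exp (K * (b - a)) := by
  have h := norm_le_of_norm_deriv_le_mul (f := fun s => f (a + b - s))
    (f' := fun s => - f' (a + b - s)) (K := K) hab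
    (fun t ht => by
      have := HasDerivWithinAt.comp_sub_Icc (c := a + b) (s := t)
        (hf (a + b - t) ⟨by linarith [ht.2], by linarith [ht.1]⟩)
      simpa using this)
    (fun t ht => by
      simpa using hK (a + b - t) ⟨by linarith [ht.2], by linarith [ht.1]⟩)
  simpa using h

/-! ### Existence for truncated Loewner fields -/

theorem norm_two_div_le {Z : ℂ} {δ : ℝ} (hδ : 0 < δ) (h : δ ≤ ‖Z‖) : ‖2 / Z‖ ≤ 2 / δ := by
  rw [norm_div, Complex.norm_ofNat]; gcongr

theorem two_div_sub_two_div {Z₁ Z₂ : ℂ} (h₁ : Z₁ ≠ 0) (h₂ : Z₂ ≠ 0) :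
    2 / Z₁ - 2 / Z₂ = -(2 / (Z₁ * Z₂)) * (Z₁ - Z₂) := by
  field_simp; ring

theorem norm_two_div_mul_le {Z₁ Z₂ : ℂ} {δ : ℝ} (hδ : 0 < δ) (h₁ : δ ≤ ‖Z₁‖) (h₂ : δ ≤ ‖Z₂‖) :
    ‖2 / (Z₁ * Z₂)‖ ≤ 2 / δ ^ 2 := by
  rw [norm_div, Complex.norm_ofNat, norm_mul, pow_two]; gcongr

/-- The Picard-Lindelöf theorem, with the solution staying in the ball. -/
theorem exists_mem_closedBall_hasDerivWithinAt {E : Type*} [NormedAddCommGroup E]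
    [NormedSpace ℝ E] [CompleteSpace E] {f : ℝ → E → E} {a b : ℝ} {t₀ : Icc a b} {x₀ : E}
    {A L K : ℝ≥0} (h : IsPicardLindelof f t₀ x₀ A 0 L K) :
    ∃ g : ℝ → E, g t₀ = x₀ ∧ (∀ t ∈ Icc a b, g t ∈ closedBall x₀ A) ∧
      ∀ t ∈ Icc a b, HasDerivWithinAt g (f t (g t)) (Icc a b) t := by
  obtain ⟨α, hα⟩ := ODE.FunSpace.exists_isFixedPt_next h (mem_closedBall_self le_rfl)
  refine ⟨α.compProj, by rw [ODE.FunSpace.compProj_val, ← hα, ODE.FunSpace.next_apply₀],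
    fun t ht => α.compProj_mem_closedBall h.mul_max_le, fun t ht => ?_⟩
  apply ODE.hasDerivWithinAt_picard_Icc t₀.2 h.continuousOn_uncurry
    α.continuous_compProj.continuousOn (fun _ ht' ↦ α.compProj_mem_closedBall h.mul_max_le)
    x₀ ht |>.congr_of_mem _ ht
  intro t' ht'
  nth_rw 1 [← hα]
  rw [ODE.FunSpace.compProj_of_mem ht', ODE.FunSpace.next_apply]

/-- Solutions of the Loewner equation whose field is precomposed with a nonexpansive map `φ`
that keeps it away from the singularity. -/
theorem exists_solution_comp {lam : ℝ → ℝ} {φ : ℂ → ℂ} {a b t₀ δ A : ℝ} {x₀ : ℂ}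
    (hlam : ContinuousOn lam (Icc a b)) (hφ : LipschitzWith 1 φ) (hδ : 0 < δ)
    (hA : 2 / δ * (b - a) ≤ A) (ht₀ : t₀ ∈ Icc a b)
    (hne : ∀ t ∈ Icc a b, ∀ h ∈ closedBall x₀ A, δ ≤ ‖φ h - lam t‖) :
    ∃ g : ℝ → ℂ, g t₀ = x₀ ∧ (∀ t ∈ Icc a b, g t ∈ closedBall x₀ A) ∧
      ∀ t ∈ Icc a b, HasDerivWithinAt g (2 / (φ (g t) - lam t)) (Icc a b) t := by
  have hba : 0 ≤ b - a := by linarith [ht₀.1, ht₀.2]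
  have hA0 : 0 ≤ A := le_trans (by positivity) hA
  obtain ⟨A, rfl⟩ : ∃ A' : ℝ≥0, (A' : ℝ) = A := ⟨⟨A, hA0⟩, rfl⟩
  obtain ⟨L, hL⟩ : ∃ L : ℝ≥0, (L : ℝ) = 2 / δ := ⟨⟨2 / δ, by positivity⟩, rfl⟩
  obtain ⟨K, hK⟩ : ∃ L : ℝ≥0, (L : ℝ) = 2 / δ ^ 2 := ⟨⟨2 / δ ^ 2, by positivity⟩, rfl⟩
  refine exists_mem_closedBall_hasDerivWithinAt (f := fun t h => 2 / (φ h - lam t))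
    (t₀ := ⟨t₀, ht₀⟩) (L := L) (K := K) ⟨fun t ht => LipschitzOnWith.of_dist_le_mul
      fun x hx y hy => ?_, fun x hx => ?_,
      fun t ht x hx => hL ▸ norm_two_div_le hδ (hne t ht x hx), ?_⟩
  · have h1 := hne t ht x hx
    have h2 := hne t ht y hy
    have n1 : φ x - lam t ≠ 0 := norm_pos_iff.1 (hδ.trans_le h1)
    have n2 : φ y - lam t ≠ 0 := norm_pos_iff.1 (hδ.trans_le h2)
    rw [dist_eq_norm, two_div_sub_two_div n1 n2, norm_mul, norm_neg, hK]
    have h3 := hφ.dist_le_mul x y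
    rw [dist_eq_norm] at h3
    simp only [NNReal.coe_one, one_mul] at h3
    refine mul_le_mul (norm_two_div_mul_le hδ h1 h2) ?_ (norm_nonneg _) (by positivity)
    simpa using h3
  · refine continuousOn_const.div (continuousOn_const.sub
      (Complex.continuous_ofReal.comp_continuousOn hlam)) fun t ht => ?_
    exact norm_pos_iff.1 (hδ.trans_le (hne t ht x hx))
  · simp only [NNReal.coe_zero, sub_zero, hL]
    refine le_trans ?_ hA
    gcongr
    exact max_le (by linarith [ht₀.1]) (by linarith [ht₀.2])

/-- Raises the imaginary part to at least `δ`. -/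
def clip (δ : ℝ) (z : ℂ) : ℂ := ⟨z.re, max z.im δ⟩

theorem clip_of_le {δ : ℝ} {z : ℂ} (h : δ ≤ z.im) : clip δ z = z := by
  apply Complex.ext <;> simp [clip, h]

theorem lipschitzWith_clip (δ : ℝ) : LipschitzWith 1 (clip δ) := by
  refine LipschitzWith.of_dist_le_mul fun x y => ?_
  simp only [NNReal.coe_one, one_mul, Complex.dist_eq_re_im, clip]
  apply Real.sqrt_le_sqrt
  have : |max x.im δ - max y.im δ| ≤ |x.im - y.im| := by
    simpa using abs_max_sub_max_le_max x.im δ y.im δ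
  have := sq_le_sq' (by linarith [neg_abs_le (x.im - y.im), abs_nonneg (max x.im δ - max y.im δ)]) this
  simp only [sq_abs] at this
  linarith

theorem le_norm_clip_sub (δ : ℝ) (z : ℂ) (x : ℝ) : δ ≤ ‖clip δ z - x‖ := by
  refine le_trans ?_ (Complex.abs_im_le_norm _)
  simp only [clip, Complex.sub_im, Complex.ofReal_im, sub_zero]
  exact le_trans (le_max_right _ _) (le_abs_self _)

theorem exists_solution_clip {lam : ℝ → ℝ} {a b t₀ δ : ℝ} (x₀ : ℂ)
    (hlam : ContinuousOn lam (Icc a b)) (hδ : 0 < δ) (ht₀ : t₀ ∈ Icc a b) :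
    ∃ g : ℝ → ℂ, g t₀ = x₀ ∧
      ∀ t ∈ Icc a b, HasDerivWithinAt g (2 / (clip δ (g t) - lam t)) (Icc a b) t := by
  obtain ⟨g, h1, -, h2⟩ := exists_solution_comp (x₀ := x₀) hlam (lipschitzWith_clip δ) hδ le_rfl ht₀
    (fun t _ h _ => le_norm_clip_sub δ h (lam t))
  exact ⟨g, h1, h2⟩

theorem two_div_im (Z : ℂ) : (2 / Z).im = -(2 * Z.im / Complex.normSq Z) := by
  simp [Complex.div_im]
  
theorem two_div_re (Z : ℂ) : (2 / Z).re = 2 * Z.re / Complex.normSq Z := by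
  simp [Complex.div_re]

theorem HasDerivWithinAt.complex_im {g : ℝ → ℂ} {g' : ℂ} {s : Set ℝ} {t : ℝ}
    (h : HasDerivWithinAt g g' s t) : HasDerivWithinAt (fun t => (g t).im) g'.im s t := by
  simpa using! Complex.imCLM.hasFDerivAt.comp_hasDerivWithinAt t h

theorem HasDerivWithinAt.complex_re {g : ℝ → ℂ} {g' : ℂ} {s : Set ℝ} {t : ℝ}
    (h : HasDerivWithinAt g g' s t) : HasDerivWithinAt (fun t => (g t).re) g'.re s t := by
  simpa using! Complex.reCLM.hasFDerivAt.comp_hasDerivWithinAt t h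

theorem HasDerivWithinAt.complex_ofReal {f : ℝ → ℝ} {f' : ℝ} {s : Set ℝ} {t : ℝ}
    (h : HasDerivWithinAt f f' s t) :
    HasDerivWithinAt (fun t => (f t : ℂ)) (f' : ℂ) s t := by
  simpa using! Complex.ofRealCLM.hasFDerivAt.comp_hasDerivWithinAt t h

theorem HasDerivWithinAt.complex_conj {g : ℝ → ℂ} {g' : ℂ} {s : Set ℝ} {t : ℝ}
    (h : HasDerivWithinAt g g' s t) :
    HasDerivWithinAt (fun t => (starRingEnd ℂ) (g t)) ((starRingEnd ℂ) g') s t := by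
  simpa using! Complex.conjCLE.toContinuousLinearMap.hasFDerivAt.comp_hasDerivWithinAt t h

theorem antitoneOn_of_hasDerivWithinAt_Icc {f f' : ℝ → ℝ} {a b : ℝ}
    (hf : ∀ t ∈ Icc a b, HasDerivWithinAt f (f' t) (Icc a b) t) (h : ∀ t ∈ Icc a b, f' t ≤ 0) :
    AntitoneOn f (Icc a b) := by
  refine antitoneOn_of_hasDerivWithinAt_nonpos (convex_Icc a b)
    (fun t ht => (hf t ht).continuousWithinAt) (f' := f') (fun t ht => ?_)
    (fun t ht => h t (interior_subset ht))
  exact (hf t (interior_subset ht)).mono interior_subset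

theorem antitoneOn_im_of_solution_clip {lam : ℝ → ℝ} {a b δ : ℝ} {g : ℝ → ℂ} (hδ : 0 < δ)
    (hg : ∀ t ∈ Icc a b, HasDerivWithinAt g (2 / (clip δ (g t) - lam t)) (Icc a b) t) :
    AntitoneOn (fun t => (g t).im) (Icc a b) := by
  refine antitoneOn_of_hasDerivWithinAt_Icc
    (fun t ht => HasDerivWithinAt.complex_im (hg t ht)) fun t ht => ?_
  rw [two_div_im, neg_nonpos]
  refine div_nonneg ?_ (Complex.normSq_nonneg _)
  simp only [clip, Complex.sub_im, Complex.ofReal_im, sub_zero]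
  have := le_max_right (g t).im δ
  linarith


/-! ### Flow lines of the Loewner equation in the upper half-plane -/

/-- `g` is a solution of the Loewner equation driven by `lam` on `[a, b]`, with values in the
upper half-plane. -/
structure Flow (lam : ℝ → ℝ) (a b : ℝ) (g : ℝ → ℂ) : Prop where
  im_pos : ∀ t ∈ Icc a b, 0 < (g t).im
  hasDeriv : ∀ t ∈ Icc a b, HasDerivWithinAt g (2 / (g t - (lam t : ℂ))) (Icc a b) t

theorem sub_ofReal_im (z : ℂ) (x : ℝ) : (z - x).im = z.im := by simp

theorem im_le_norm_sub (z : ℂ) (x : ℝ) : z.im ≤ ‖z - x‖ := by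
  simpa using (le_abs_self _).trans (Complex.abs_im_le_norm (z - x))

theorem sub_ofReal_ne_zero {z : ℂ} (x : ℝ) (h : 0 < z.im) : z - x ≠ 0 :=
  norm_pos_iff.1 (h.trans_le (im_le_norm_sub z x))

namespace Flow

variable {lam lam' : ℝ → ℝ} {a b a' b' c t : ℝ} {g g' g₁ g₂ : ℝ → ℂ}

theorem mono (h : Flow lam a b g) (ha : a ≤ a') (hb : b' ≤ b) : Flow lam a' b' g :=
  ⟨fun t ht => h.im_pos t (Icc_subset_Icc ha hb ht),
    fun t ht => (h.hasDeriv t (Icc_subset_Icc ha hb ht)).mono (Icc_subset_Icc ha hb)⟩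

theorem congr_driver (h : Flow lam a b g) (hl : EqOn lam' lam (Icc a b)) : Flow lam' a b g :=
  ⟨h.im_pos, fun t ht => by rw [hl ht]; exact h.hasDeriv t ht⟩

theorem congr (h : Flow lam a b g) (hg : EqOn g' g (Icc a b)) : Flow lam a b g' :=
  ⟨fun t ht => by rw [hg ht]; exact h.im_pos t ht, fun t ht => by
    rw [hg ht]; exact (h.hasDeriv t ht).congr_of_mem hg ht⟩

theorem continuousOn (h : Flow lam a b g) : ContinuousOn g (Icc a b) :=
  fun t ht => (h.hasDeriv t ht).continuousWithinAt

theorem antitoneOn_im (h : Flow lam a b g) : AntitoneOn (fun t => (g t).im) (Icc a b) := by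
  refine antitoneOn_of_hasDerivWithinAt_Icc
    (fun t ht => HasDerivWithinAt.complex_im (h.hasDeriv t ht)) fun t ht => ?_
  rw [two_div_im, neg_nonpos, sub_ofReal_im]
  exact div_nonneg (by linarith [h.im_pos t ht]) (Complex.normSq_nonneg _)

theorem im_right_le (h : Flow lam a b g) (ht : t ∈ Icc a b) : (g b).im ≤ (g t).im :=
  h.antitoneOn_im ht (right_mem_Icc.2 (ht.1.trans ht.2)) ht.2

theorem glue (h₁ : Flow lam a b g₁) (h₂ : Flow lam b c g₂) (h : g₁ b = g₂ b) (hab : a ≤ b)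
    (hbc : b ≤ c) : Flow lam a c (fun t => if t ≤ b then g₁ t else g₂ t) := by
  set F : ℝ → ℂ := fun t => if t ≤ b then g₁ t else g₂ t with hF
  have e₁ : EqOn F g₁ (Icc a b) := fun t ht => by simp [hF, ht.2]
  have e₂ : EqOn F g₂ (Icc b c) := fun t ht => by
    rcases ht.1.eq_or_lt with rfl | hlt
    · simp [hF, h]
    · simp [hF, not_le.2 hlt]
  have f₁ := h₁.congr e₁
  have f₂ := h₂.congr e₂
  refine ⟨fun t ht => ?_, fun t ht => ?_⟩
  · rcases le_total t b with htb | htb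
    · exact f₁.im_pos t ⟨ht.1, htb⟩
    · exact f₂.im_pos t ⟨htb, ht.2⟩
  · rcases lt_trichotomy t b with htb | htb | htb
    · refine (f₁.hasDeriv t ⟨ht.1, htb.le⟩).mono_of_mem_nhdsWithin ?_
      filter_upwards [self_mem_nhdsWithin, mem_nhdsWithin_of_mem_nhds (Iio_mem_nhds htb)] with s h1 h2
      exact ⟨h1.1, le_of_lt h2⟩
    · subst htb
      have := (f₁.hasDeriv t ⟨hab, le_rfl⟩).union (f₂.hasDeriv t ⟨le_rfl, hbc⟩)
      rwa [Icc_union_Icc_eq_Icc hab hbc] at this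
    · refine (f₂.hasDeriv t ⟨htb.le, ht.2⟩).mono_of_mem_nhdsWithin ?_
      filter_upwards [self_mem_nhdsWithin, mem_nhdsWithin_of_mem_nhds (Ioi_mem_nhds htb)] with s h1 h2
      exact ⟨le_of_lt h2, h1.2⟩

theorem hasDeriv_sub (h₁ : Flow lam a b g₁) (h₂ : Flow lam a b g₂) (ht : t ∈ Icc a b) :
    HasDerivWithinAt (fun t => g₁ t - g₂ t)
      (-(2 / ((g₁ t - lam t) * (g₂ t - lam t))) * (g₁ t - g₂ t)) (Icc a b) t := by
  have := (h₁.hasDeriv t ht).sub (h₂.hasDeriv t ht)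
  rw [two_div_sub_two_div (sub_ofReal_ne_zero _ (h₁.im_pos t ht))
    (sub_ofReal_ne_zero _ (h₂.im_pos t ht))] at this
  simpa using! this

theorem norm_sub_bounds {y : ℝ} (h₁ : Flow lam a b g₁) (h₂ : Flow lam a b g₂) (hab : a ≤ b)
    (hy : 0 < y) (hy₁ : y ≤ (g₁ b).im) (hy₂ : y ≤ (g₂ b).im) :
    ‖g₁ b - g₂ b‖ ≤ ‖g₁ a - g₂ a‖ * Real.exp (2 / y ^ 2 * (b - a)) ∧
    ‖g₁ a - g₂ a‖ ≤ ‖g₁ b - g₂ b‖ * Real.exp (2 / y ^ 2 * (b - a)) := by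
  have hK : ∀ t ∈ Icc a b, ‖-(2 / ((g₁ t - lam t) * (g₂ t - lam t))) * (g₁ t - g₂ t)‖ ≤
      2 / y ^ 2 * ‖g₁ t - g₂ t‖ := fun t ht => by
    rw [norm_mul, norm_neg]
    gcongr
    exact norm_two_div_mul_le hy ((hy₁.trans (h₁.im_right_le ht)).trans (im_le_norm_sub _ _))
      ((hy₂.trans (h₂.im_right_le ht)).trans (im_le_norm_sub _ _))
  exact ⟨norm_le_of_norm_deriv_le_mul hab (fun t ht => h₁.hasDeriv_sub h₂ ht) hK,
    norm_le_of_norm_deriv_le_mul_left hab (fun t ht => h₁.hasDeriv_sub h₂ ht) hK⟩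

theorem eqOn (h₁ : Flow lam a b g₁) (h₂ : Flow lam a b g₂) (ht : t ∈ Icc a b)
    (h : g₁ t = g₂ t) : EqOn g₁ g₂ (Icc a b) := by
  intro s hs
  rcases le_total s t with hst | hst
  · have f₁ := h₁.mono hs.1 ht.2
    have f₂ := h₂.mono hs.1 ht.2
    have := (f₁.norm_sub_bounds f₂ hst (lt_min (h₁.im_pos t ht) (h₂.im_pos t ht))
      (min_le_left _ _) (min_le_right _ _)).2
    rw [h, sub_self, norm_zero, zero_mul] at this
    exact sub_eq_zero.1 (norm_le_zero_iff.1 this)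
  · have f₁ := h₁.mono ht.1 hs.2
    have f₂ := h₂.mono ht.1 hs.2
    have := (f₁.norm_sub_bounds f₂ hst (lt_min (h₁.im_pos s hs) (h₂.im_pos s hs))
      (min_le_left _ _) (min_le_right _ _)).1
    rw [h, sub_self, norm_zero, zero_mul] at this
    exact sub_eq_zero.1 (norm_le_zero_iff.1 this)

/-- A solution of the Loewner equation that starts in the upper half-plane and does not hit the
driving function stays in the upper half-plane. -/
theorem of_ne (hlam : ContinuousOn lam (Icc a b)) (ha : 0 < (g a).im)
    (hne : ∀ t ∈ Icc a b, g t ≠ lam t)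
    (hg : ∀ t ∈ Icc a b, HasDerivWithinAt g (2 / (g t - (lam t : ℂ))) (Icc a b) t) :
    Flow lam a b g := by
  refine ⟨fun t ht => ?_, hg⟩
  have hgc : ContinuousOn g (Icc a b) := fun t ht => (hg t ht).continuousWithinAt
  have hZc : ContinuousOn (fun t => ‖g t - lam t‖) (Icc a b) :=
    (hgc.sub (Complex.continuous_ofReal.comp_continuousOn hlam)).norm
  have hab : a ≤ b := ht.1.trans ht.2
  obtain ⟨m, hm, hmin⟩ := isCompact_Icc.exists_isMinOn (nonempty_Icc.2 hab) hZc
  have hδ : 0 < ‖g m - lam m‖ := norm_pos_iff.2 (sub_ne_zero.2 (hne m hm))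
  have key : ∀ s ∈ Icc a b, (g s).im ≠ 0 := by
    intro s hs h0
    have hsub : Icc a s ⊆ Icc a b := Icc_subset_Icc_right hs.2
    have := norm_le_of_norm_deriv_le_mul_left (f := fun t => g t - (starRingEnd ℂ) (g t))
      (f' := fun t => -(2 / ((g t - lam t) * ((starRingEnd ℂ) (g t) - lam t))) *
        (g t - (starRingEnd ℂ) (g t))) (K := 2 / ‖g m - lam m‖ ^ 2) hs.1 (fun t ht => ?_)
        (fun t ht => ?_)
    · simp only [Complex.sub_conj, h0] at this
      simp at this
      exact ha.ne' (abs_nonpos_iff.1 (by linarith))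
    · have h1 := ((hg t (hsub ht)).mono hsub).sub
        (HasDerivWithinAt.complex_conj ((hg t (hsub ht)).mono hsub))
      have hz : g t - lam t ≠ 0 := sub_ne_zero.2 (hne t (hsub ht))
      have hz' : (starRingEnd ℂ) (g t) - lam t ≠ 0 := by
        have := (map_ne_zero (starRingEnd ℂ)).2 hz
        simpa using this
      have h2 := two_div_sub_two_div hz hz'
      have h3 : (starRingEnd ℂ) (2 / (g t - lam t)) = 2 / ((starRingEnd ℂ) (g t) - lam t) := by
        simp [map_div₀, map_sub, Complex.conj_ofNat]
      rw [h3, h2] at h1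
      simpa using! h1
    · rw [norm_mul, norm_neg]
      gcongr
      refine norm_two_div_mul_le hδ (hmin (hsub ht)) ?_
      have h3 : (starRingEnd ℂ) (g t) - lam t = (starRingEnd ℂ) (g t - lam t) := by simp
      rw [h3, Complex.norm_conj]
      exact hmin (hsub ht)
  by_contra hcon
  push Not at hcon
  have hc : ContinuousOn (fun t => (g t).im) (Icc a t) :=
    (Complex.continuous_im.comp_continuousOn hgc).mono (Icc_subset_Icc_right ht.2)
  obtain ⟨s, hs, hs0⟩ := intermediate_value_Icc' ht.1 hc ⟨hcon, ha.le⟩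
  exact key s ⟨hs.1, hs.2.trans ht.2⟩ hs0

end Flow

theorem exists_flow_of_right {lam : ℝ → ℝ} {a b : ℝ} {w : ℂ} (hlam : ContinuousOn lam (Icc a b))
    (hab : a ≤ b) (hw : 0 < w.im) : ∃ g, Flow lam a b g ∧ g b = w := by
  obtain ⟨g, hgb, hg⟩ := exists_solution_clip w hlam hw (right_mem_Icc.2 hab)
  have hanti := antitoneOn_im_of_solution_clip hw hg
  have him : ∀ t ∈ Icc a b, w.im ≤ (g t).im := fun t ht => by
    have := hanti ht (right_mem_Icc.2 hab) ht.2
    simpa [hgb] using this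
  refine ⟨g, ⟨fun t ht => hw.trans_le (him t ht), fun t ht => ?_⟩, hgb⟩
  have := hg t ht
  rwa [clip_of_le (him t ht)] at this

/-- Flow lines persist for as long as the driving function stays far away. -/
theorem exists_flow_of_left {lam : ℝ → ℝ} {a b δ : ℝ} {w : ℂ} (hlam : ContinuousOn lam (Icc a b))
    (hab : a ≤ b) (hw : 0 < w.im) (hδ : 0 < δ) (hwδ : δ ≤ ‖w - lam a‖)
    (hosc : ∀ t ∈ Icc a b, |lam t - lam a| ≤ δ / 4) (hb : b - a ≤ δ ^ 2 / 16) :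
    ∃ g, Flow lam a b g ∧ g a = w := by
  have hfar : ∀ t ∈ Icc a b, ∀ h ∈ closedBall w (δ / 4), δ / 2 ≤ ‖h - lam t‖ := by
    intro t ht h hh
    have h1 : ‖h - w‖ ≤ δ / 4 := by simpa [dist_eq_norm] using hh
    have h2 := hosc t ht
    have h3 : ‖((lam t : ℂ)) - lam a‖ ≤ δ / 4 := by
      rw [← Complex.ofReal_sub, Complex.norm_real]; exact h2
    have h4 : ‖w - lam a‖ ≤ ‖h - lam t‖ + ‖h - w‖ + ‖((lam t : ℂ)) - lam a‖ := by
      have : w - lam a = (h - lam t) - (h - w) + ((lam t : ℂ) - lam a) := by ring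
      rw [this]
      exact (norm_add_le _ _).trans (by gcongr; exact norm_sub_le _ _)
    linarith
  obtain ⟨g, h1, h2, h3⟩ := exists_solution_comp (φ := id) (δ := δ / 2) (A := δ / 4) (x₀ := w)
    hlam LipschitzWith.id (by positivity) (by
      rw [div_mul_eq_mul_div, div_le_iff₀ (by positivity)]; nlinarith) (left_mem_Icc.2 hab) hfar
  refine ⟨g, Flow.of_ne hlam (h1 ▸ hw) (fun t ht h => ?_) h3, h1⟩
  have := hfar t ht _ (h2 t ht)
  rw [h, sub_self, norm_zero] at this
  linarith

/-- Nearby initial points have nearby flow lines, of the same lifetime. -/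
theorem Flow.exists_near {lam : ℝ → ℝ} {a b : ℝ} {g : ℝ → ℂ} (hlam : ContinuousOn lam (Icc a b))
    (hab : a ≤ b) (h : Flow lam a b g) : ∃ δ > 0, ∃ K, ∀ z, ‖z - g a‖ < δ →
      ∃ g', Flow lam a b g' ∧ g' a = z ∧ ‖g' b - g b‖ ≤ K * ‖z - g a‖ := by
  set y := (g b).im with hy
  have hy0 : 0 < y := h.im_pos b (right_mem_Icc.2 hab)
  set E := Real.exp (2 / (y / 2) ^ 2 * (b - a)) with hE
  refine ⟨y / 2 / E, by positivity, E, fun z hz => ?_⟩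
  obtain ⟨g', h0, hg'⟩ := exists_solution_clip z hlam (half_pos hy0) (left_mem_Icc.2 hab)
  have hclip : ∀ t ∈ Icc a b, clip (y / 2) (g t) = g t := fun t ht =>
    clip_of_le (by linarith [h.im_right_le ht])
  have hle : ∀ s ∈ Icc a b, ‖g' s - g s‖ ≤ E * ‖z - g a‖ := by
    intro s hs
    have hsub : Icc a s ⊆ Icc a b := Icc_subset_Icc_right hs.2
    have := norm_le_of_norm_deriv_le_mul (f := fun t => g' t - g t)
      (f' := fun t => 2 / (clip (y / 2) (g' t) - lam t) - 2 / (g t - lam t))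
      (K := 2 / (y / 2) ^ 2) hs.1 (fun t ht => ?_) (fun t ht => ?_)
    · rw [h0] at this
      rw [mul_comm]
      refine this.trans ?_
      rw [hE]
      gcongr
      exact hs.2
    · exact (((hg' t (hsub ht)).sub (h.hasDeriv t (hsub ht))).mono hsub)
    · have n1 := le_norm_clip_sub (y / 2) (g' t) (lam t)
      have n2 : y / 2 ≤ ‖g t - lam t‖ := by
        have := le_norm_clip_sub (y / 2) (g t) (lam t)
        rwa [hclip t (hsub ht)] at this
      rw [two_div_sub_two_div (norm_pos_iff.1 (by linarith)) (norm_pos_iff.1 (by linarith)),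
        norm_mul, norm_neg]
      refine mul_le_mul (norm_two_div_mul_le (half_pos hy0) n1 n2) ?_ (norm_nonneg _) (by positivity)
      have := (lipschitzWith_clip (y / 2)).dist_le_mul (g' t) (g t)
      rw [hclip t (hsub ht)] at this
      simpa [dist_eq_norm] using this
  have him : ∀ t ∈ Icc a b, y / 2 ≤ (g' t).im := by
    intro t ht
    have h1 := hle t ht
    have h2 : E * ‖z - g a‖ < y / 2 := by
      rw [mul_comm]; exact (lt_div_iff₀ (by positivity)).1 hz
    have h3 := (Complex.abs_im_le_norm (g' t - g t)).trans h1
    rw [Complex.sub_im] at h3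
    have := neg_abs_le ((g' t).im - (g t).im)
    linarith [h.im_right_le ht]
  refine ⟨g', ⟨fun t ht => (half_pos hy0).trans_le (him t ht), fun t ht => ?_⟩, h0,
    hle b (right_mem_Icc.2 hab)⟩
  have := hg' t ht
  rwa [clip_of_le (him t ht)] at this


/-! ### Capture by the driving function -/

/-- The flow line of `z`, started at time `a`, is not captured up to time `b`. -/
def Alive (lam : ℝ → ℝ) (a b : ℝ) (z : ℂ) : Prop := ∃ g, Flow lam a b g ∧ g a = z

/-- The flow line `g` of `z`, started at time `a`, hits the driving function at time `T`. -/
structure Captured (lam : ℝ → ℝ) (a : ℝ) (z : ℂ) (T : ℝ) (g : ℝ → ℂ) : Prop where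
  lt : a < T
  initial : g a = z
  flow : ∀ s < T, Flow lam a s g
  tendsto : Tendsto (fun s => g s - (lam s : ℂ)) (𝓝[<] T) (𝓝 0)

theorem Alive.mono {lam : ℝ → ℝ} {a b b' : ℝ} {z : ℂ} (h : Alive lam a b z) (hb : b' ≤ b) :
    Alive lam a b' z := by
  obtain ⟨g, hg, hz⟩ := h
  exact ⟨g, hg.mono le_rfl hb, hz⟩

theorem Alive.self {a : ℝ} {z : ℂ} (lam : ℝ → ℝ) (hz : 0 < z.im) : Alive lam a a z := by
  obtain ⟨g, hg, h⟩ := exists_flow_of_right (lam := lam) (a := a) (b := a)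
    (by rw [Icc_self]; exact continuousOn_singleton _ _) le_rfl hz
  exact ⟨g, hg, h⟩

theorem exists_forall_alive_extend {lam : ℝ → ℝ} {a b T δ : ℝ} (hlam : ContinuousOn lam (Icc a b))
    (hT : T ∈ Icc a b) (hδ : 0 < δ) : ∃ η > 0, ∀ s ∈ Icc a T, T - s < η → ∀ g, Flow lam a s g →
      δ ≤ ‖g s - lam s‖ → Alive lam a (min b (T + η)) (g a) := by
  obtain ⟨η, hη, hosc⟩ := Metric.continuousOn_iff.1 hlam T hT (δ / 8) (by positivity)
  refine ⟨min (η / 2) (δ ^ 2 / 32), by positivity, fun s hs hTs g hg hfar => ?_⟩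
  set e := min (η / 2) (δ ^ 2 / 32)
  have e1 : e ≤ η / 2 := min_le_left _ _
  have e2 : e ≤ δ ^ 2 / 32 := min_le_right _ _
  have hsm : s ≤ min b (T + e) := le_min (hs.2.trans hT.2) (by linarith [hs.2, sub_nonneg.2 hs.2])
  have hosc' : ∀ t ∈ Icc s (min b (T + e)), |lam t - lam T| < δ / 8 := fun t ht => by
    have h1 := ht.2.trans (min_le_right _ _)
    have := hosc t ⟨hs.1.trans ht.1, ht.2.trans (min_le_left _ _)⟩ (by
      rw [Real.dist_eq, abs_lt]; constructor <;> linarith [ht.1])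
    simpa [Real.dist_eq] using this
  obtain ⟨g', hg', h0⟩ := exists_flow_of_left (hlam.mono (Icc_subset_Icc hs.1 (min_le_left _ _)))
    hsm (hg.im_pos s ⟨hs.1, le_rfl⟩) hδ hfar (fun t ht => by
      have h1 := hosc' t ht
      have h2 := hosc' s ⟨le_rfl, hsm⟩
      rw [abs_lt] at h1 h2
      rw [abs_le]; constructor <;> linarith) (by
      have := min_le_right b (T + e)
      linarith)
  refine ⟨_, hg.glue hg' h0.symm hs.1 hsm, by simp [hs.1]⟩

theorem alive_or_captured {lam : ℝ → ℝ} {a b : ℝ} {z : ℂ} (hlam : ContinuousOn lam (Icc a b))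
    (hab : a ≤ b) (hz : 0 < z.im) :
    Alive lam a b z ∨ ∃ T ∈ Ioc a b, ∃ g, Captured lam a z T g := by
  classical
  by_contra hcon
  push Not at hcon
  obtain ⟨hdead, hcap⟩ := hcon
  set S := {s | s ∈ Icc a b ∧ Alive lam a s z} with hS
  have haS : a ∈ S := ⟨left_mem_Icc.2 hab, Alive.self lam hz⟩
  have hbdd : BddAbove S := ⟨b, fun s hs => hs.1.2⟩
  set T := sSup S with hTdef
  have haT : a ≤ T := le_csSup hbdd haS
  have hTb : T ≤ b := csSup_le ⟨a, haS⟩ fun s hs => hs.1.2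
  have hext : ∀ δ > 0, ∃ η > 0, ∀ s ∈ Icc a T, T - s < η → ∀ g, Flow lam a s g → g a = z →
      ‖g s - lam s‖ < δ := by
    intro δ hδ
    obtain ⟨η, hη, h⟩ := exists_forall_alive_extend hlam ⟨haT, hTb⟩ hδ
    refine ⟨η, hη, fun s hs hTs g hg hga => ?_⟩
    by_contra hfar
    have h1 := h s hs hTs g hg (not_lt.1 hfar)
    rw [hga] at h1
    rcases le_total b (T + η) with hb | hb
    · rw [min_eq_left hb] at h1
      exact hdead h1
    · rw [min_eq_right hb] at h1
      have : T + η ≤ T := le_csSup hbdd ⟨⟨by linarith, hb⟩, h1⟩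
      linarith
  have haT' : a < T := by
    rcases haT.eq_or_lt with h | h
    · exfalso
      obtain ⟨η, hη, h1⟩ := hext z.im hz
      obtain ⟨g, hg, hga⟩ := Alive.self (a := a) lam hz
      have := h1 a ⟨le_rfl, haT⟩ (by linarith) g hg hga
      have h2 := im_le_norm_sub (g a) (lam a)
      rw [hga] at h2 this
      linarith
    · exact h
  have halive : ∀ s < T, Alive lam a s z := fun s hs => by
    obtain ⟨s', hs', hlt⟩ := exists_lt_of_lt_csSup ⟨a, haS⟩ hs
    exact hs'.2.mono hlt.le
  set G : ℝ → ℂ := fun s => if h : Alive lam a s z then h.choose s else 0 with hG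
  have hflow : ∀ s < T, Flow lam a s G := fun s hs => by
    refine (halive s hs).choose_spec.1.congr fun t ht => ?_
    have htT : t < T := ht.2.trans_lt hs
    simp only [hG, dif_pos (halive t htT)]
    refine (halive t htT).choose_spec.1.eqOn ((halive s hs).choose_spec.1.mono le_rfl ht.2)
      (left_mem_Icc.2 ht.1) ?_ (right_mem_Icc.2 ht.1)
    rw [(halive t htT).choose_spec.2, (halive s hs).choose_spec.2]
  have hGa : G a = z := by
    simp only [hG, dif_pos (halive a haT')]
    exact (halive a haT').choose_spec.2
  refine hcap T ⟨haT', hTb⟩ G ⟨haT', hGa, hflow, ?_⟩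
  rw [Metric.tendsto_nhdsWithin_nhds]
  intro δ hδ
  obtain ⟨η, hη, h⟩ := hext δ hδ
  refine ⟨min η (T - a), lt_min hη (by linarith), fun s hs hd => ?_⟩
  rw [Real.dist_eq, abs_lt] at hd
  have h1 := min_le_left η (T - a)
  have h2 := min_le_right η (T - a)
  have hs' : s < T := hs
  simpa using h s ⟨by linarith, hs'.le⟩ (by linarith) G (hflow s hs) hGa

/-! ### Displacement of points near the driving function -/

theorem Flow.norm_sub_sq_left_le {lam : ℝ → ℝ} {a b x ρ A : ℝ} {g : ℝ → ℂ} (h : Flow lam a b g)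
    (hab : a ≤ b) (hρ : 0 < ρ) (hosc : ∀ t ∈ Icc a b, |lam t - x| ≤ ρ) (hA : 2 * ρ ≤ A)
    (hg : ‖g b - x‖ ≤ A) : ‖g a - x‖ ^ 2 ≤ A ^ 2 + 9 * (b - a) := by
  have hA0 : 0 < A := by linarith
  have hd : ∀ s ∈ Icc (b - b) (b - a), HasDerivWithinAt (fun s => ‖g (b - s) - x‖ ^ 2)
      (2 * inner ℝ (g (b - s) - x) (-(2 / (g (b - s) - lam (b - s)))))
      (Icc (b - b) (b - a)) s := fun s hs => by
    have hs' : b - s ∈ Icc a b := ⟨by linarith [hs.2], by linarith [hs.1]⟩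
    exact ((HasDerivWithinAt.comp_sub_Icc (h.hasDeriv _ hs')).sub_const (x : ℂ)).norm_sq
  have key := image_le_of_deriv_right_lt_deriv_boundary' (B := fun s => A ^ 2 + 9 * s)
    (B' := fun _ => 9) (fun s hs => (hd s hs).continuousWithinAt)
    (fun s hs => HasDerivWithinAt.Ici_of_Icc (hd s (Ico_subset_Icc_self hs)) hs)
    (by simp; gcongr) (by fun_prop)
    (fun s _ => by simpa using (((hasDerivAt_id s).const_mul 9).const_add (A ^ 2)).hasDerivWithinAt)
    (fun s hs heq => ?_) (right_mem_Icc.2 (by linarith : b - b ≤ b - a))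
  · simpa using key
  · have hs0 : 0 ≤ s := by linarith [hs.1]
    have hs' : b - s ∈ Icc a b := ⟨by linarith [hs.2], by linarith [hs.1]⟩
    set N := ‖g (b - s) - x‖ with hN
    have hNA : A ≤ N := by
      have : A ^ 2 ≤ N ^ 2 := by rw [heq]; linarith
      exact le_of_sq_le_sq this (norm_nonneg _)
    have hZ : N / 2 ≤ ‖g (b - s) - lam (b - s)‖ := by
      have h1 : ‖((lam (b - s) : ℂ)) - x‖ ≤ ρ := by
        rw [← Complex.ofReal_sub, Complex.norm_real]; exact hosc _ hs'
      have h2 : g (b - s) - x = (g (b - s) - lam (b - s)) + (lam (b - s) - x) := by ring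
      have h3 := norm_add_le (g (b - s) - lam (b - s)) ((lam (b - s) : ℂ) - x)
      rw [← h2] at h3
      linarith
    have hN0 : 0 < N := by linarith
    have h1 := norm_two_div_le (by linarith : 0 < N / 2) hZ
    have h2 := real_inner_le_norm (g (b - s) - x) (-(2 / (g (b - s) - lam (b - s))))
    rw [norm_neg] at h2
    have h3 : N * ‖2 / (g (b - s) - lam (b - s))‖ ≤ N * (2 / (N / 2)) := by gcongr
    have h4 : N * (2 / (N / 2)) = 4 := by field_simp; norm_num
    linarith

theorem exists_forall_norm_sub_left_lt {lam : ℝ → ℝ} {T ε : ℝ} (hlam : ContinuousOn lam (Ici 0))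
    (hT : 0 ≤ T) (hε : 0 < ε) : ∃ δ > 0, ∀ s t, 0 ≤ s → s ≤ t → |s - T| < δ → |t - T| < δ →
      ∀ g, Flow lam s t g → ‖g t - lam t‖ < δ → ‖g s - lam s‖ < ε := by
  obtain ⟨η, hη, hosc⟩ := Metric.continuousOn_iff.1 hlam T hT (ε / 8) (by positivity)
  refine ⟨min η (min (ε / 8) (ε ^ 2 / 144)), by positivity, fun s t hs hst hsT htT g hg hgt => ?_⟩
  set δ := min η (min (ε / 8) (ε ^ 2 / 144))
  have d1 : δ ≤ η := min_le_left _ _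
  have d2 : δ ≤ ε / 8 := (min_le_right _ _).trans (min_le_left _ _)
  have d3 : δ ≤ ε ^ 2 / 144 := (min_le_right _ _).trans (min_le_right _ _)
  rw [abs_lt] at hsT htT
  have ho : ∀ r ∈ Icc s t, |lam r - lam T| ≤ ε / 8 := fun r hr => by
    have := hosc r (hs.trans hr.1) (by
      rw [Real.dist_eq, abs_lt]; constructor <;> linarith [hr.1, hr.2])
    exact (by simpa [Real.dist_eq] using this : |lam r - lam T| < ε / 8).le
  have hn : ∀ r ∈ Icc s t, ‖((lam r : ℂ)) - lam T‖ ≤ ε / 8 := fun r hr => by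
    rw [← Complex.ofReal_sub, Complex.norm_real]; exact ho r hr
  have h1 : ‖g t - lam T‖ ≤ ε / 4 := by
    have := norm_add_le (g t - lam t) ((lam t : ℂ) - lam T)
    rw [sub_add_sub_cancel] at this
    linarith [hn t ⟨hst, le_rfl⟩]
  have h2 := hg.norm_sub_sq_left_le hst (by positivity) ho (by linarith) h1
  have h3 : ‖g s - lam T‖ ≤ ε / 2 := by
    refine le_of_sq_le_sq (h2.trans ?_) (by positivity)
    nlinarith
  have h4 := norm_sub_le (g s - lam T) ((lam s : ℂ) - lam T)
  rw [sub_sub_sub_cancel_right] at h4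
  linarith [hn s ⟨le_rfl, hst⟩]

/-! ### Existence of the trace -/

/-- Flow lines ending near the tip at times `t ≤ T` close to `T` are, at some earlier time `a`,
close to each other and away from the real line. -/
def LocalLeft (lam : ℝ → ℝ) (T : ℝ) : Prop :=
  ∃ a, 0 ≤ a ∧ a < T ∧ ∃ y > 0, ∀ ε > 0, ∃ δ > 0, ∀ t ∈ Ioc a T, T - t < δ → ∀ g g',
    Flow lam a t g → Flow lam a t g' → ‖g t - lam t‖ < δ → ‖g' t - lam t‖ < δ →
      ‖g a - g' a‖ < ε ∧ y ≤ (g a).im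

theorem LocalLeft.congr {lam lam' : ℝ → ℝ} {T : ℝ} (h : LocalLeft lam T)
    (hl : EqOn lam' lam (Icc 0 T)) : LocalLeft lam' T := by
  obtain ⟨a, ha, haT, y, hy, h⟩ := h
  refine ⟨a, ha, haT, y, hy, fun ε hε => ?_⟩
  obtain ⟨δ, hδ, h⟩ := h ε hε
  refine ⟨δ, hδ, fun t ht htT g g' hg hg' h1 h2 => ?_⟩
  rw [hl ⟨by linarith [ht.1], ht.2⟩] at h1 h2
  have hl' : EqOn lam lam' (Icc a t) := fun s hs =>
    (hl ⟨ha.trans hs.1, hs.2.trans ht.2⟩).symm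
  exact h t ht htT g g' (hg.congr_driver hl') (hg'.congr_driver hl') h1 h2

theorem exists_forall_norm_sub_initial_lt {lam : ℝ → ℝ} {T ε : ℝ}
    (hlam : ContinuousOn lam (Ici 0)) (hT : 0 ≤ T) (hloc : 0 < T → LocalLeft lam T)
    (hε : 0 < ε) : ∃ δ > 0, ∀ t t', 0 ≤ t → 0 ≤ t' → |t - T| < δ → |t' - T| < δ → ∀ g g',
      Flow lam 0 t g → Flow lam 0 t' g' → ‖g t - lam t‖ < δ → ‖g' t' - lam t'‖ < δ →
      ‖g 0 - g' 0‖ < ε := by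
  rcases hT.eq_or_lt with rfl | hT'
  · obtain ⟨δ, hδ, h⟩ := exists_forall_norm_sub_left_lt hlam le_rfl (half_pos hε)
    refine ⟨δ, hδ, fun t t' ht ht' htT htT' g g' hg hg' h1 h2 => ?_⟩
    have e1 := h 0 t le_rfl ht (by simpa) htT g hg h1
    have e2 := h 0 t' le_rfl ht' (by simpa) htT' g' hg' h2
    have := norm_sub_le (g 0 - lam 0) (g' 0 - lam 0)
    rw [sub_sub_sub_cancel_right] at this
    linarith
  · obtain ⟨a, ha, haT, y, hy, hl⟩ := hloc hT'
    set E := Real.exp (2 / y ^ 2 * (a - 0)) with hE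
    have hE0 : 0 < E := Real.exp_pos _
    obtain ⟨δ₁, hδ₁, hl⟩ := hl (ε / E) (by positivity)
    obtain ⟨δ₂, hδ₂, hs⟩ := exists_forall_norm_sub_left_lt hlam hT hδ₁
    refine ⟨min (min δ₁ δ₂) (T - a), lt_min (lt_min hδ₁ hδ₂) (by linarith),
      fun t t' ht ht' htT htT' g g' hg hg' h1 h2 => ?_⟩
    set δ := min (min δ₁ δ₂) (T - a)
    have d1 : δ ≤ δ₁ := (min_le_left _ _).trans (min_le_left _ _)
    have d2 : δ ≤ δ₂ := (min_le_left _ _).trans (min_le_right _ _)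
    have d3 : δ ≤ T - a := min_le_right _ _
    set m := min (min t t') T with hm
    have htT2 := abs_lt.1 htT
    have htT2' := abs_lt.1 htT'
    have m1 : m ≤ t := (min_le_left _ _).trans (min_le_left _ _)
    have m2 : m ≤ t' := (min_le_left _ _).trans (min_le_right _ _)
    have m3 : m ≤ T := min_le_right _ _
    have m4 : T - δ < m := lt_min (lt_min (by linarith) (by linarith)) (by linarith)
    have m5 : |m - T| < δ := by rw [abs_lt]; constructor <;> linarith
    have m6 : a < m := by linarith
    have f1 := hs m t (by linarith) m1 (by linarith) (by linarith) g
      (hg.mono (by linarith) le_rfl) (by linarith)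
    have f2 := hs m t' (by linarith) m2 (by linarith) (by linarith) g'
      (hg'.mono (by linarith) le_rfl) (by linarith)
    have k1 := hl m ⟨m6, m3⟩ (by linarith) g g' (hg.mono ha m1) (hg'.mono ha m2) f1 f2
    have k2 := hl m ⟨m6, m3⟩ (by linarith) g' g (hg'.mono ha m2) (hg.mono ha m1) f2 f1
    have := ((hg.mono le_rfl (m6.le.trans m1)).norm_sub_bounds
      (hg'.mono le_rfl (m6.le.trans m2)) ha hy k1.2 k2.2).2
    calc ‖g 0 - g' 0‖ ≤ ‖g a - g' a‖ * E := this
      _ < ε / E * E := by gcongr; exact k1.1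
      _ = ε := by field_simp

theorem exists_flow_near_tip {lam : ℝ → ℝ} {t δ : ℝ} (hlam : ContinuousOn lam (Ici 0))
    (ht : 0 ≤ t) (hδ : 0 < δ) : ∃ g, Flow lam 0 t g ∧ ‖g t - lam t‖ < δ := by
  obtain ⟨g, hg, h⟩ := exists_flow_of_right (w := lam t + (δ / 2 : ℝ) * Complex.I)
    (hlam.mono Icc_subset_Ici_self) ht (by simpa using hδ)
  refine ⟨g, hg, ?_⟩
  rw [h, add_sub_cancel_left, norm_mul, Complex.norm_I, mul_one, Complex.norm_real,
    Real.norm_of_nonneg (by positivity)]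
  linarith

/-- `p` is the tip at time `T`: the limit of initial points of flow lines that end near the
driving function at times close to `T`. -/
def IsTip (lam : ℝ → ℝ) (T : ℝ) (p : ℂ) : Prop :=
  ∀ ε > 0, ∃ δ > 0, ∀ t, 0 ≤ t → |t - T| < δ → ∀ g, Flow lam 0 t g → ‖g t - lam t‖ < δ →
    ‖g 0 - p‖ < ε

theorem exists_isTip {lam : ℝ → ℝ} {T : ℝ} (hlam : ContinuousOn lam (Ici 0)) (hT : 0 ≤ T)
    (hloc : 0 < T → LocalLeft lam T) : ∃ p, IsTip lam T p := by
  have hpos : ∀ n : ℕ, (0 : ℝ) < 1 / (n + 1) := fun n => by positivity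
  choose G hG hGn using fun n : ℕ => exists_flow_near_tip hlam hT (hpos n)
  have hlim := tendsto_one_div_add_atTop_nhds_zero_nat (𝕜 := ℝ)
  have hcau : CauchySeq fun n => G n 0 := by
    rw [Metric.cauchySeq_iff]
    intro ε hε
    obtain ⟨δ, hδ, h⟩ := exists_forall_norm_sub_initial_lt hlam hT hloc hε
    obtain ⟨N, hN⟩ := eventually_atTop.1 (hlim.eventually (gt_mem_nhds hδ))
    refine ⟨N, fun m hm n hn => ?_⟩
    rw [dist_eq_norm]
    exact h T T hT hT (by simpa) (by simpa) _ _ (hG m) (hG n) ((hGn m).trans (hN m hm))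
      ((hGn n).trans (hN n hn))
  obtain ⟨p, hp⟩ := cauchySeq_tendsto_of_complete hcau
  refine ⟨p, fun ε hε => ?_⟩
  obtain ⟨δ, hδ, h⟩ := exists_forall_norm_sub_initial_lt hlam hT hloc (half_pos hε)
  refine ⟨δ, hδ, fun t ht htT g hg hgt => ?_⟩
  obtain ⟨n, hn1, hn2⟩ := ((hlim.eventually (gt_mem_nhds hδ)).and
    (hp.eventually (Metric.ball_mem_nhds p (half_pos hε)))).exists
  have h1 := h t T ht hT htT (by simpa) g (G n) hg (hG n) hgt ((hGn n).trans hn1)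
  have h2 : ‖G n 0 - p‖ < ε / 2 := by simpa [dist_eq_norm] using hn2
  have := norm_add_le (g 0 - G n 0) (G n 0 - p)
  rw [sub_add_sub_cancel] at this
  linarith

theorem Captured.eq_tip {lam : ℝ → ℝ} {T : ℝ} {z p : ℂ} {g : ℝ → ℂ} (h : Captured lam 0 z T g)
    (hp : IsTip lam T p) : z = p := by
  by_contra hne
  obtain ⟨δ, hδ, hp⟩ := hp ‖z - p‖ (norm_pos_iff.2 (sub_ne_zero.2 hne))
  obtain ⟨η, hη, ht⟩ := Metric.tendsto_nhdsWithin_nhds.1 h.tendsto δ hδ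
  have hm : 0 < min (min η δ) T := lt_min (lt_min hη hδ) h.lt
  set m := min (min η δ) T
  have m1 : m ≤ η := (min_le_left _ _).trans (min_le_left _ _)
  have m2 : m ≤ δ := (min_le_left _ _).trans (min_le_right _ _)
  have m3 : m ≤ T := min_le_right _ _
  have h1 : |T - m / 2 - T| = m / 2 := by
    rw [show T - m / 2 - T = -(m / 2) by ring, abs_neg, abs_of_pos (half_pos hm)]
  have h2 := ht (show T - m / 2 ∈ Iio T from by simp [hm]) (by rw [Real.dist_eq, h1]; linarith)
  have h3 := hp (T - m / 2) (by linarith) (by rw [h1]; linarith) g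
    (h.flow _ (by linarith)) (by simpa using h2)
  rw [h.initial] at h3
  exact lt_irrefl _ h3

theorem IsTip.not_alive {lam : ℝ → ℝ} {T : ℝ} {p : ℂ} (hlam : ContinuousOn lam (Ici 0))
    (hT : 0 ≤ T) (hp : IsTip lam T p) : ¬ Alive lam 0 T p := by
  rintro ⟨g, hg, h0⟩
  obtain ⟨δ, hδ, K, hK⟩ := hg.exists_near (hlam.mono Icc_subset_Ici_self) hT
  have hy : 0 < (g T).im := hg.im_pos T ⟨hT, le_rfl⟩
  set y := (g T).im
  obtain ⟨δ', hδ', h⟩ := hp (min δ (y / (2 * (|K| + 1)))) (lt_min hδ (by positivity))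
  obtain ⟨g₁, hg₁, h₁⟩ := exists_flow_near_tip hlam hT (lt_min hδ' (half_pos hy))
  have h2 := h T hT (by simpa) g₁ hg₁ (h₁.trans_le (min_le_left _ _))
  rw [← h0] at h2
  obtain ⟨g', hg', h3, h4⟩ := hK (g₁ 0) (h2.trans_le (min_le_left _ _))
  have h5 := hg'.eqOn hg₁ (left_mem_Icc.2 hT) h3 (right_mem_Icc.2 hT)
  rw [h5] at h4
  have h6 : K * ‖g₁ 0 - g 0‖ ≤ y / 2 := by
    have e1 : ‖g₁ 0 - g 0‖ ≤ y / (2 * (|K| + 1)) := (h2.trans_le (min_le_right _ _)).le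
    calc K * ‖g₁ 0 - g 0‖ ≤ (|K| + 1) * (y / (2 * (|K| + 1))) := by
          gcongr; linarith [le_abs_self K]
      _ = y / 2 := by field_simp
  have h7 : ‖g₁ T - lam T‖ < y / 2 := h₁.trans_le (min_le_right _ _)
  have h8 : y ≤ ‖g T - lam T‖ := im_le_norm_sub _ _
  have h9 := norm_sub_le (g₁ T - lam T) (g₁ T - g T)
  rw [show g₁ T - lam T - (g₁ T - g T) = g T - lam T by ring] at h9
  linarith

/-! ### Hulls and fillings -/

theorem Alive.lt_lifetime {lam : ℝ → ℝ} {t : ℝ} {z : ℂ} (hlam : ContinuousOn lam (Ici 0))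
    (ht : 0 ≤ t) (h : Alive lam 0 t z) : ENNReal.ofReal t < lifetime lam z := by
  obtain ⟨g, hg, h0⟩ := h
  obtain ⟨η, hη, hext⟩ := exists_forall_alive_extend (b := t + 1)
    (hlam.mono Icc_subset_Ici_self) ⟨ht, by linarith⟩ (hg.im_pos t ⟨ht, le_rfl⟩)
  obtain ⟨g', hg', h0'⟩ := hext t ⟨ht, le_rfl⟩ (by linarith) g hg (im_le_norm_sub _ _)
  set b := min (t + 1) (t + η)
  have hb : t < b := lt_min (by linarith) (by linarith)
  refine lt_of_lt_of_le ((ENNReal.ofReal_lt_ofReal_iff (ht.trans_lt hb)).2 hb) ?_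
  refine le_iSup₂_of_le (f := fun (T : ℝ≥0) (_ : ∃ g : ℝ → ℂ, IsSolution lam z T g) => (T : ℝ≥0∞))
    b.toNNReal ⟨g', ?_⟩ le_rfl
  rw [Real.coe_toNNReal _ (ht.trans hb.le)]
  refine ⟨h0'.trans h0, fun s hs => ?_, fun s hs => ?_⟩
  · exact sub_ne_zero.1 (sub_ofReal_ne_zero _ (hg'.im_pos s (Ico_subset_Icc_self hs)))
  · exact (hg'.hasDeriv s (Ico_subset_Icc_self hs)).mono Ico_subset_Icc_self

theorem alive_of_lt_lifetime {lam : ℝ → ℝ} {t : ℝ} {z : ℂ} (hlam : ContinuousOn lam (Ici 0))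
    (hz : 0 < z.im) (h : ENNReal.ofReal t < lifetime lam z) : Alive lam 0 t z := by
  simp only [lifetime, lt_iSup_iff] at h
  obtain ⟨T, ⟨g, hg⟩, hT⟩ := h
  have hT' : t < T := by
    rcases lt_or_ge t 0 with h | h
    · exact h.trans_le T.2
    · rwa [← ENNReal.ofReal_coe_nnreal, ENNReal.ofReal_lt_ofReal_iff_of_nonneg h] at hT
  have hsub : Icc 0 t ⊆ Ico 0 (T : ℝ) := fun s hs => ⟨hs.1, hs.2.trans_lt hT'⟩
  exact ⟨g, Flow.of_ne (hlam.mono Icc_subset_Ici_self) (by rwa [hg.initial])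
    (fun s hs => hg.ne_driving s (hsub hs)) fun s hs => (hg.hasDeriv s (hsub hs)).mono hsub,
    hg.initial⟩

theorem hull_eq_not_alive {lam : ℝ → ℝ} {t : ℝ} (hlam : ContinuousOn lam (Ici 0)) (ht : 0 ≤ t) :
    hull lam t = {z | 0 < z.im ∧ ¬ Alive lam 0 t z} := by
  ext z
  simp only [hull, mem_ofPred_eq, and_congr_right_iff]
  intro hz
  rw [← not_lt, not_iff_not]
  exact ⟨alive_of_lt_lifetime hlam hz, fun h => h.lt_lifetime hlam ht⟩

theorem isPreconnected_alive {lam : ℝ → ℝ} {t : ℝ} (hlam : ContinuousOn lam (Ici 0)) (ht : 0 ≤ t) :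
    IsPreconnected {z | 0 < z.im ∧ Alive lam 0 t z} := by
  have hlam' := hlam.mono (Icc_subset_Ici_self : Icc 0 t ⊆ Ici 0)
  choose! G hG hGt using fun (w : ℂ) (hw : 0 < w.im) => exists_flow_of_right hlam' ht hw
  have himg : {z | 0 < z.im ∧ Alive lam 0 t z} = (fun w => G w 0) '' {w | 0 < w.im} := by
    ext z
    constructor
    · rintro ⟨-, g, hg, rfl⟩
      have hw := hg.im_pos t ⟨ht, le_rfl⟩
      refine ⟨g t, hw, ?_⟩
      exact (hG _ hw).eqOn hg (right_mem_Icc.2 ht) (hGt _ hw) (left_mem_Icc.2 ht)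
    · rintro ⟨w, hw, rfl⟩
      exact ⟨(hG w hw).im_pos 0 ⟨le_rfl, ht⟩, G w, hG w hw, rfl⟩
  rw [himg]
  refine (convex_halfSpace_im_gt 0).isPreconnected.image _ fun w hw => ?_
  have hw' : 0 < w.im := hw
  set E := Real.exp (2 / (w.im / 2) ^ 2 * (t - 0)) with hE
  refine ContinuousAt.continuousWithinAt (Metric.continuousAt_iff.2 fun ε hε =>
    ⟨min (w.im / 2) (ε / E), by positivity, fun v hv => ?_⟩)
  rw [dist_eq_norm] at hv ⊢
  have hvim : w.im / 2 ≤ v.im := by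
    have := (Complex.abs_im_le_norm (v - w)).trans (hv.le.trans (min_le_left _ _))
    rw [Complex.sub_im] at this
    linarith [neg_abs_le (v.im - w.im)]
  have hv' : 0 < v.im := by linarith
  have := ((hG v hv').norm_sub_bounds (hG w hw') ht (half_pos hw') (by rw [hGt v hv']; exact hvim)
    (by rw [hGt w hw']; linarith)).2
  rw [hGt v hv', hGt w hw'] at this
  calc ‖G v 0 - G w 0‖ ≤ ‖v - w‖ * E := this
    _ < ε / E * E := by gcongr; exact hv.trans_le (min_le_right _ _)
    _ = ε := div_mul_cancel₀ _ (Real.exp_pos _).ne'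

theorem not_isBounded_alive {lam : ℝ → ℝ} {t : ℝ} (hlam : ContinuousOn lam (Ici 0)) (ht : 0 ≤ t) :
    ¬ Bornology.IsBounded {z | 0 < z.im ∧ Alive lam 0 t z} := by
  intro hb
  obtain ⟨M, hM⟩ := hb.exists_norm_le
  obtain ⟨g, hg, h⟩ := exists_flow_of_right (w := ((|M| + 1 : ℝ) : ℂ) * Complex.I)
    (hlam.mono Icc_subset_Ici_self) ht (by simp; positivity)
  have h1 := hM (g 0) ⟨hg.im_pos 0 ⟨le_rfl, ht⟩, g, hg, rfl⟩
  have h2 := hg.im_right_le (t := 0) ⟨le_rfl, ht⟩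
  rw [h] at h2
  have h3 := Complex.abs_im_le_norm (g 0)
  simp only [Complex.im_ofReal_mul, Complex.I_im, mul_one] at h2
  linarith [le_abs_self M, le_abs_self (g 0).im]

/-- A driving function with the local property `LocalLeft` at all positive times has a trace, which
passes through exactly the captured points, at their capture times. -/
theorem exists_isTrace {lam : ℝ → ℝ} (hlam : ContinuousOn lam (Ici 0))
    (hloc : ∀ T, 0 < T → LocalLeft lam T) :
    ∃ γ, IsTrace lam γ ∧ ∀ t, 0 ≤ t → IsTip lam t (γ t) := by
  choose! γ hγ using fun T (hT : 0 ≤ T) => exists_isTip hlam hT (hloc T)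
  refine ⟨γ, ⟨hlam, ?_, ?_, ?_⟩, hγ⟩
  · refine Metric.continuousOn_iff.2 fun T hT ε hε => ?_
    obtain ⟨δ, hδ, h⟩ := hγ T hT (ε / 2) (half_pos hε)
    refine ⟨δ, hδ, fun t ht htT => ?_⟩
    obtain ⟨δ', hδ', h'⟩ := hγ t ht (ε / 2) (half_pos hε)
    obtain ⟨g, hg, hgt⟩ := exists_flow_near_tip hlam ht (lt_min hδ hδ')
    have h1 := h t ht (by rwa [Real.dist_eq] at htT) g hg (hgt.trans_le (min_le_left _ _))
    have h2 := h' t ht (by simpa) g hg (hgt.trans_le (min_le_right _ _))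
    rw [dist_eq_norm]
    have := norm_sub_le (g 0 - γ T) (g 0 - γ t)
    rw [sub_sub_sub_cancel_left] at this
    linarith
  · intro t ht
    by_contra hneg
    obtain ⟨δ, hδ, h⟩ := hγ t ht (-(γ t).im) (by linarith)
    obtain ⟨g, hg, hgt⟩ := exists_flow_near_tip hlam ht hδ
    have h1 := h t ht (by simpa) g hg hgt
    have h2 := (Complex.abs_im_le_norm (g 0 - γ t))
    rw [Complex.sub_im] at h2
    linarith [le_abs_self ((g 0).im - (γ t).im), hg.im_pos 0 ⟨le_rfl, ht⟩]
  · intro t ht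
    have hcompl : {w : ℂ | 0 < w.im} \ γ '' Icc 0 t = {z | 0 < z.im ∧ Alive lam 0 t z} := by
      ext z
      constructor
      · rintro ⟨hz, hzγ⟩
        have hz' : 0 < z.im := hz
        refine ⟨hz, ?_⟩
        rcases alive_or_captured (hlam.mono Icc_subset_Ici_self) ht hz' with h | ⟨T, hT, g, hg⟩
        · exact h
        · exact absurd ⟨T, Ioc_subset_Icc_self hT, (hg.eq_tip (hγ T hT.1.le)).symm⟩ hzγ
      · rintro ⟨hz, hal⟩
        refine ⟨hz, ?_⟩
        rintro ⟨s, hs, rfl⟩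
        exact (hγ s hs.1).not_alive hlam hs.1 (hal.mono hs.2)
    rw [hull_eq_not_alive hlam ht, filling, hcompl]
    ext z
    simp only [mem_ofPred_eq, and_congr_right_iff]
    intro hz
    by_cases hal : Alive lam 0 t z
    · rw [(isPreconnected_alive hlam ht).connectedComponentIn ⟨hz, hal⟩]
      exact iff_of_false (fun h => h hal) (not_isBounded_alive hlam ht)
    · rw [connectedComponentIn_eq_empty fun h => hal h.2]
      exact iff_of_true hal Bornology.isBounded_empty


/-! ### The trace near a tip at which the driving function is differentiable -/

theorem Flow.hasDeriv_sub_driver_reverse {lam lam' : ℝ → ℝ} {a t s : ℝ} {g : ℝ → ℂ}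
    (h : Flow lam a t g) (hd : ∀ r ∈ Icc a t, HasDerivWithinAt lam (lam' r) (Icc a t) r)
    (hs : s ∈ Icc 0 (t - a)) :
    HasDerivWithinAt (fun s => (g (t - s) - lam (t - s)) ^ 2)
      (-4 + 2 * (g (t - s) - lam (t - s)) * lam' (t - s)) (Icc 0 (t - a)) s := by
  have hs' : t - s ∈ Icc a t := ⟨by linarith [hs.2], by linarith [hs.1]⟩
  have h1 := HasDerivWithinAt.comp_sub_Icc
    ((h.hasDeriv _ hs').sub (HasDerivWithinAt.complex_ofReal (hd _ hs')))
  rw [sub_self] at h1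
  have h2 := h1.pow 2
  have hne := sub_ofReal_ne_zero (lam (t - s)) (h.im_pos _ hs')
  refine (h2.congr_deriv ?_)
  simp only [Pi.sub_apply]
  field_simp
  ring

theorem Flow.norm_sq_add_le {lam lam' : ℝ → ℝ} {a t L ρ : ℝ} {g : ℝ → ℂ} (h : Flow lam a t g)
    (hd : ∀ r ∈ Icc a t, HasDerivWithinAt lam (lam' r) (Icc a t) r)
    (hL : ∀ r ∈ Icc a t, |lam' r| ≤ L) (hL0 : 0 < L)
    (hsmall : 4 * L ^ 2 * (5 * (t - a) + ρ ^ 2) < 1)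
    (hg : ‖g t - lam t‖ ≤ ρ) : ∀ s ∈ Icc 0 (t - a),
    ‖(g (t - s) - lam (t - s)) ^ 2 - (g t - lam t) ^ 2 + 4 * s‖ ≤ s := by
  have hd' : ∀ s ∈ Icc 0 (t - a), HasDerivWithinAt
      (fun s : ℝ => (g (t - s) - lam (t - s)) ^ 2 - (g t - lam t) ^ 2 + 4 * (s : ℂ))
      (2 * (g (t - s) - lam (t - s)) * lam' (t - s)) (Icc 0 (t - a)) s := fun s hs => by
    have h1 := (h.hasDeriv_sub_driver_reverse hd hs).sub_const ((g t - lam t) ^ 2)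
    have h2 := (HasDerivWithinAt.complex_ofReal (hasDerivWithinAt_id s (Icc 0 (t - a)))).const_mul 4
    refine (h1.add h2).congr_deriv ?_
    push_cast; ring
  refine image_norm_le_of_norm_deriv_right_lt_deriv_boundary' (B := fun s => s) (B' := fun _ => 1)
    (fun s hs => (hd' s hs).continuousWithinAt)
    (fun s hs => HasDerivWithinAt.Ici_of_Icc (hd' s (Ico_subset_Icc_self hs)) hs) (by simp)
    continuousOn_id (fun s _ => hasDerivWithinAt_id s _) fun s hs heq => ?_
  have hs' : t - s ∈ Icc a t := ⟨by linarith [hs.2], by linarith [hs.1]⟩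
  set Z := g (t - s) - lam (t - s) with hZ
  have h1 : ‖Z‖ ^ 2 ≤ 5 * s + ρ ^ 2 := by
    have e : Z ^ 2 = (Z ^ 2 - (g t - lam t) ^ 2 + 4 * s) + (g t - lam t) ^ 2 - 4 * s := by ring
    rw [← norm_pow, e]
    refine (norm_sub_le _ _).trans ((add_le_add_left (norm_add_le _ _) _).trans ?_)
    rw [heq, norm_pow, norm_mul, Complex.norm_real, Real.norm_of_nonneg hs.1, Complex.norm_ofNat]
    have : ‖g t - lam t‖ ^ 2 ≤ ρ ^ 2 := by gcongr
    linarith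
  rw [norm_mul, norm_mul, Complex.norm_real, Complex.norm_ofNat, Real.norm_eq_abs]
  have h2 : 2 * ‖Z‖ * |lam' (t - s)| ≤ 2 * ‖Z‖ * L := by
    gcongr; exact hL _ hs'
  refine h2.trans_lt ?_
  refine lt_of_pow_lt_pow_left₀ 2 zero_le_one ?_
  calc (2 * ‖Z‖ * L) ^ 2 = 4 * L ^ 2 * ‖Z‖ ^ 2 := by ring
    _ ≤ 4 * L ^ 2 * (5 * (t - a) + ρ ^ 2) := by
        gcongr; linarith [hs.2]
    _ < 1 ^ 2 := by simpa using hsmall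

theorem sqrt_two_mul_le_im {Z W : ℂ} {s : ℝ} (hZ : 0 < Z.im) (hW : ‖W‖ ≤ s)
    (h : ‖Z ^ 2 - W + 4 * s‖ ≤ s) : √(2 * s) ≤ Z.im := by
  refine Real.sqrt_le_iff.2 ⟨hZ.le, ?_⟩
  have h1 := (Complex.abs_re_le_norm _).trans h
  have h2 := (Complex.abs_re_le_norm _).trans hW
  have h3 := (abs_le.1 h1).2
  have h4 := (abs_le.1 h2).2
  simp only [Complex.add_re, Complex.sub_re, pow_two, Complex.mul_re, Complex.ofReal_re,
    Complex.ofReal_im, mul_zero, sub_zero, Complex.re_ofNat] at h3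
  nlinarith [sq_nonneg Z.re]

theorem Flow.norm_sub_left_le_of_tip {lam lam' : ℝ → ℝ} {a t L ρ : ℝ} {g₁ g₂ : ℝ → ℂ}
    (h₁ : Flow lam a t g₁) (h₂ : Flow lam a t g₂)
    (hd : ∀ r ∈ Icc a t, HasDerivWithinAt lam (lam' r) (Icc a t) r)
    (hL : ∀ r ∈ Icc a t, |lam' r| ≤ L) (hL0 : 0 < L) (hρ : 0 < ρ)
    (hsmall : 4 * L ^ 2 * (5 * (t - a) + ρ ^ 2) < 1) (hρt : ρ ^ 2 ≤ t - a)
    (hg₁ : ‖g₁ t - lam t‖ ≤ ρ) (hg₂ : ‖g₂ t - lam t‖ ≤ ρ) :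
    √(2 * (t - a)) ≤ (g₁ a).im ∧
    ‖g₁ a - g₂ a‖ * √(t - a) ≤ 5 * ρ ^ 2 * Real.exp (2 * L * √(t - a)) := by
  have k₁ := h₁.norm_sq_add_le hd hL hL0 hsmall hg₁
  have k₂ := h₂.norm_sq_add_le hd hL hL0 hsmall hg₂
  have hw : ∀ g : ℝ → ℂ, ‖g t - lam t‖ ≤ ρ → ‖(g t - lam t) ^ 2‖ ≤ ρ ^ 2 := fun g hg => by
    rw [norm_pow]; gcongr
  have hy : ∀ g, Flow lam a t g → ‖g t - lam t‖ ≤ ρ → ∀ s ∈ Icc (ρ ^ 2) (t - a),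
      √(2 * s) ≤ (g (t - s)).im := by
    intro g h hg s hs
    have hs' : t - s ∈ Icc a t := ⟨by linarith [hs.2], by nlinarith [hs.1]⟩
    have := sqrt_two_mul_le_im (Z := g (t - s) - lam (t - s)) (by simpa using h.im_pos _ hs')
      ((hw g hg).trans hs.1)
      (h.norm_sq_add_le hd hL hL0 hsmall hg s ⟨by nlinarith [hs.1], hs.2⟩)
    simpa using this
  have hdiff : ∀ s ∈ Icc (ρ ^ 2) (t - a), ‖g₁ (t - s) - g₂ (t - s)‖ * (2 * √(2 * s)) ≤
      ‖(g₁ (t - s) - lam (t - s)) ^ 2 - (g₂ (t - s) - lam (t - s)) ^ 2‖ := by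
    intro s hs
    have e : (g₁ (t - s) - lam (t - s)) ^ 2 - (g₂ (t - s) - lam (t - s)) ^ 2 =
      (g₁ (t - s) - g₂ (t - s)) * ((g₁ (t - s) - lam (t - s)) + (g₂ (t - s) - lam (t - s))) := by
      ring
    rw [e, norm_mul]
    gcongr
    have := (le_abs_self _).trans (Complex.abs_im_le_norm
      ((g₁ (t - s) - lam (t - s)) + (g₂ (t - s) - lam (t - s))))
    simp only [Complex.add_im, sub_ofReal_im] at this
    linarith [hy g₁ h₁ hg₁ s hs, hy g₂ h₂ hg₂ s hs]
  have hmem : t - a ∈ Icc (ρ ^ 2) (t - a) := ⟨hρt, le_rfl⟩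
  have hsub : Icc (ρ ^ 2) (t - a) ⊆ Icc 0 (t - a) := Icc_subset_Icc_left (by positivity)
  have hdW : ∀ s ∈ Icc (ρ ^ 2) (t - a), HasDerivWithinAt
      (fun s => (g₁ (t - s) - lam (t - s)) ^ 2 - (g₂ (t - s) - lam (t - s)) ^ 2)
      (2 * (g₁ (t - s) - g₂ (t - s)) * lam' (t - s)) (Icc (ρ ^ 2) (t - a)) s := fun s hs => by
    refine (((h₁.hasDeriv_sub_driver_reverse hd (hsub hs)).sub
      (h₂.hasDeriv_sub_driver_reverse hd (hsub hs))).mono hsub).congr_deriv ?_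
    ring
  have key := image_norm_le_of_norm_deriv_right_lt_deriv_boundary'
    (B := fun s => 5 * ρ ^ 2 * Real.exp (2 * L * √s))
    (B' := fun s => 5 * ρ ^ 2 * (Real.exp (2 * L * √s) * (2 * L * (1 / (2 * √s)))))
    (fun s hs => (hdW s hs).continuousWithinAt)
    (fun s hs => HasDerivWithinAt.Ici_of_Icc (hdW s (Ico_subset_Icc_self hs)) hs) ?_
    (by fun_prop) (fun s hs => ?_) (fun s hs heq => ?_) hmem
  · refine ⟨by simpa using hy g₁ h₁ hg₁ (t - a) hmem, ?_⟩
    have h3 := (hdiff _ hmem).trans key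
    simp only [sub_sub_cancel] at h3
    refine le_trans ?_ h3
    gcongr
    have : √(t - a) ≤ √(2 * (t - a)) := Real.sqrt_le_sqrt (by nlinarith)
    linarith [Real.sqrt_nonneg (t - a)]
  · have e1 := k₁ (ρ ^ 2) ⟨by positivity, hρt⟩
    have e2 := k₂ (ρ ^ 2) ⟨by positivity, hρt⟩
    have e3 := hw g₁ hg₁
    have e4 := hw g₂ hg₂
    have h1 : (1 : ℝ) ≤ Real.exp (2 * L * √(ρ ^ 2)) := Real.one_le_exp (by positivity)
    have h2 : (g₁ (t - ρ ^ 2) - lam (t - ρ ^ 2)) ^ 2 - (g₂ (t - ρ ^ 2) - lam (t - ρ ^ 2)) ^ 2 =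
      ((g₁ (t - ρ ^ 2) - lam (t - ρ ^ 2)) ^ 2 - (g₁ t - lam t) ^ 2 + 4 * ((ρ ^ 2 : ℝ) : ℂ)) -
      ((g₂ (t - ρ ^ 2) - lam (t - ρ ^ 2)) ^ 2 - (g₂ t - lam t) ^ 2 + 4 * ((ρ ^ 2 : ℝ) : ℂ)) +
      ((g₁ t - lam t) ^ 2 - (g₂ t - lam t) ^ 2) := by ring
    rw [h2]
    refine (norm_add_le _ _).trans ((add_le_add (norm_sub_le _ _) (norm_sub_le _ _)).trans ?_)
    nlinarith [sq_nonneg ρ]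
  · have hs0 : 0 < s := lt_of_lt_of_le (by positivity) hs.1
    exact ((((Real.hasDerivAt_sqrt hs0.ne').const_mul (2 * L)).exp.const_mul
      (5 * ρ ^ 2))).hasDerivWithinAt
  · have hs0 : 0 < s := lt_of_lt_of_le (by positivity) hs.1
    have hs' : t - s ∈ Icc a t := ⟨by linarith [hs.2], by linarith⟩
    have h3 := hdiff s (Ico_subset_Icc_self hs)
    rw [heq] at h3
    rw [norm_mul, norm_mul, Complex.norm_real, Complex.norm_ofNat, Real.norm_eq_abs]
    set D := ‖g₁ (t - s) - g₂ (t - s)‖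
    set B := 5 * ρ ^ 2 * Real.exp (2 * L * √s) with hB
    have hB0 : 0 < B := by positivity
    have hsq : 0 < √s := Real.sqrt_pos.2 hs0
    have hlt : √s < √(2 * s) := Real.sqrt_lt_sqrt hs0.le (by linarith)
    have hD0 : 0 ≤ D := norm_nonneg _
    have h4 : 2 * D * |lam' (t - s)| ≤ 2 * D * L := by gcongr; exact hL _ hs'
    refine h4.trans_lt ?_
    have h5 : 5 * ρ ^ 2 * (Real.exp (2 * L * √s) * (2 * L * (1 / (2 * √s)))) = B * L / √s := by
      rw [hB]; field_simp
    rw [h5, lt_div_iff₀ hsq]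
    have h6 : 2 * D * √s < B := by
      rcases hD0.eq_or_lt with h | h
      · rw [← h]; simpa using hB0
      · nlinarith
    nlinarith

theorem localLeft_of_bounded_deriv {lam lam' : ℝ → ℝ} {a T L : ℝ} (ha : 0 ≤ a) (haT : a < T)
    (hd : ∀ r ∈ Icc a T, HasDerivWithinAt lam (lam' r) (Icc a T) r)
    (hL : ∀ r ∈ Icc a T, |lam' r| ≤ L) : LocalLeft lam T := by
  wlog hL0 : 0 < L generalizing L
  · exact this (L := |L| + 1) (fun r hr => (hL r hr).trans (by linarith [le_abs_self L]))
      (by positivity)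
  set σ := min (T - a) (1 / (44 * L ^ 2)) with hσ
  have hσ0 : 0 < σ := lt_min (by linarith) (by positivity)
  have hσ1 : σ ≤ T - a := min_le_left _ _
  have hσ2 : 44 * L ^ 2 * σ ≤ 1 := by
    have : σ ≤ 1 / (44 * L ^ 2) := min_le_right _ _
    rw [le_div_iff₀ (by positivity)] at this
    linarith
  refine ⟨T - σ, by linarith, by linarith, √σ, Real.sqrt_pos.2 hσ0, fun ε hε => ?_⟩
  set E := Real.exp (2 * L * √σ) with hE
  refine ⟨min (min 1 (σ / 2)) (ε * √(σ / 2) / (10 * E)), by positivity,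
    fun t ht htT g g' hg hg' h1 h2 => ?_⟩
  set δ := min (min 1 (σ / 2)) (ε * √(σ / 2) / (10 * E)) with hδ
  have hδ0 : 0 < δ := by positivity
  have d1 : δ ≤ 1 := (min_le_left _ _).trans (min_le_left _ _)
  have d2 : δ ≤ σ / 2 := (min_le_left _ _).trans (min_le_right _ _)
  have d3 : δ ≤ ε * √(σ / 2) / (10 * E) := min_le_right _ _
  have d4 : δ ^ 2 ≤ δ := by nlinarith
  have hsub : Icc (T - σ) t ⊆ Icc a T := Icc_subset_Icc (by linarith) ht.2
  have hlen : t - (T - σ) ≤ σ := by linarith [ht.2]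
  have hlen' : σ / 2 ≤ t - (T - σ) := by linarith
  obtain ⟨k1, k2⟩ := hg.norm_sub_left_le_of_tip hg' (ρ := δ)
    (fun r hr => (hd r (hsub hr)).mono hsub) (fun r hr => hL r (hsub hr)) hL0 hδ0
    (by nlinarith [sq_nonneg L, mul_pos (pow_pos hL0 2) hσ0]) (by linarith) h1.le h2.le
  refine ⟨?_, le_trans (Real.sqrt_le_sqrt (by linarith)) k1⟩
  have k3 : ‖g (T - σ) - g' (T - σ)‖ * √(σ / 2) ≤ 5 * δ * E := by
    calc ‖g (T - σ) - g' (T - σ)‖ * √(σ / 2)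
        ≤ ‖g (T - σ) - g' (T - σ)‖ * √(t - (T - σ)) := by gcongr
      _ ≤ 5 * δ ^ 2 * Real.exp (2 * L * √(t - (T - σ))) := k2
      _ ≤ 5 * δ * E := by rw [hE]; gcongr
  rw [le_div_iff₀ (by positivity)] at d3
  have hs : 0 < √(σ / 2) := Real.sqrt_pos.2 (by positivity)
  by_contra hcon
  push Not at hcon
  have : ε * √(σ / 2) ≤ ‖g (T - σ) - g' (T - σ)‖ * √(σ / 2) := by gcongr
  nlinarith [mul_pos hε hs]


/-! ### Two quantities attached to a pair of flow lines -/

theorem HasDerivWithinAt.log_norm {f : ℝ → ℂ} {c : ℂ} {s : Set ℝ} {t : ℝ}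
    (h : HasDerivWithinAt f (c * f t) s t) (h0 : f t ≠ 0) :
    HasDerivWithinAt (fun t => Real.log ‖f t‖) c.re s t := by
  have h1 := (h.norm_sq).log (pow_ne_zero 2 (norm_ne_zero_iff.2 h0))
  have h2 : (fun t => Real.log ‖f t‖) = fun t => (1 / 2) * Real.log (‖f t‖ ^ 2) := by
    funext t; rw [Real.log_pow]; push_cast; ring
  rw [h2]
  refine (h1.const_mul (1 / 2)).congr_deriv ?_
  have h3 : ‖f t‖ ^ 2 ≠ 0 := pow_ne_zero 2 (norm_ne_zero_iff.2 h0)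
  have h4 : inner ℝ (f t) (c * f t) = c.re * ‖f t‖ ^ 2 := by
    rw [Complex.inner, mul_assoc, Complex.mul_conj, Complex.normSq_eq_norm_sq]
    exact Complex.re_mul_ofReal _ _
  rw [h4]
  field_simp

theorem neg_two_div_mul_eq {z w : ℂ} (hw : w ≠ 0) :
    -(2 / (z * w)) = z⁻¹ * (starRingEnd ℂ) w * ((-2 / Complex.normSq w : ℝ) : ℂ) := by
  have hn : (starRingEnd ℂ) w ≠ 0 := (map_ne_zero _).2 hw
  push_cast
  rw [Complex.normSq_eq_conj_mul_self]
  by_cases hz : z = 0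
  · simp [hz]
  · field_simp

theorem im_add_im_eq {z w : ℂ} {κ : ℝ} (hw : w ≠ 0) (hκ : w.re = κ * w.im) :
    (-(2 / (z * w))).im + (-(2 / (z * (starRingEnd ℂ) w))).im =
      κ * ((-(2 / (z * w))).re - (-(2 / (z * (starRingEnd ℂ) w))).re) := by
  rw [neg_two_div_mul_eq hw, neg_two_div_mul_eq ((map_ne_zero _).2 hw)]
  simp only [Complex.normSq_conj, Complex.conj_conj, Complex.mul_re, Complex.mul_im, Complex.ofReal_re,
    Complex.ofReal_im, Complex.conj_re, Complex.conj_im, hκ]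
  ring

theorem potential_identity {z w : ℂ} {κ : ℝ} (hw : w ≠ 0) (hκ : w.re = κ * w.im) :
    (1 + κ ^ 2) * (-(2 / (z * w))).re + (1 - κ ^ 2) * (-(2 / (z * (starRingEnd ℂ) w))).re -
      2 * κ * (-(2 / (z * (starRingEnd ℂ) w))).im = 0 := by
  rw [neg_two_div_mul_eq hw, neg_two_div_mul_eq ((map_ne_zero _).2 hw)]
  simp only [Complex.normSq_conj, Complex.conj_conj, Complex.mul_re, Complex.mul_im, Complex.ofReal_re,
    Complex.ofReal_im, Complex.conj_re, Complex.conj_im, hκ]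
  ring

/-- A unimodular function of two points of the upper half-plane. If `κ` is the cotangent of the
argument of `q` as seen from the driving function, then it is locally constant along the flow
as long as `κ` is. -/
noncomputable def phase (κ : ℝ) (p q : ℂ) : ℂ :=
  (p - q) * (p - (starRingEnd ℂ) q) *
    Complex.exp (-((κ * (Real.log ‖p - q‖ - Real.log ‖p - (starRingEnd ℂ) q‖) : ℝ) : ℂ) * Complex.I
      - ((Real.log ‖p - q‖ + Real.log ‖p - (starRingEnd ℂ) q‖ : ℝ) : ℂ))

/-- The logarithmic size of `p - q` corrected by terms that are bounded for `p` close to `q`. -/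
noncomputable def potential (κ : ℝ) (p q : ℂ) : ℝ :=
  (1 + κ ^ 2) * Real.log ‖p - q‖ + (1 - κ ^ 2) * Real.log ‖p - (starRingEnd ℂ) q‖ -
    2 * κ * Complex.arg (p - (starRingEnd ℂ) q)

theorem conj_sub_ofReal (q : ℂ) (x : ℝ) :
    (starRingEnd ℂ) q - x = (starRingEnd ℂ) (q - x) := by simp

theorem sub_conj_im_pos {p q : ℂ} (hp : 0 < p.im) (hq : 0 < q.im) :
    0 < (p - (starRingEnd ℂ) q).im := by
  simp only [Complex.sub_im, Complex.conj_im]; linarith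

theorem sub_conj_ne_zero {p q : ℂ} (hp : 0 < p.im) (hq : 0 < q.im) :
    p - (starRingEnd ℂ) q ≠ 0 := fun h => by
  have := sub_conj_im_pos hp hq
  rw [h] at this
  exact lt_irrefl _ this

theorem norm_sub_le_norm_sub_conj {p q : ℂ} (hp : 0 < p.im) (hq : 0 < q.im) :
    ‖p - q‖ ≤ ‖p - (starRingEnd ℂ) q‖ := by
  refine le_of_sq_le_sq ?_ (norm_nonneg _)
  rw [← Complex.normSq_eq_norm_sq, ← Complex.normSq_eq_norm_sq, Complex.normSq_apply,
    Complex.normSq_apply]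
  simp only [Complex.sub_re, Complex.sub_im, Complex.conj_re, Complex.conj_im]
  nlinarith [mul_pos hp hq]

namespace Flow

variable {lam : ℝ → ℝ} {a b t κ : ℝ} {g q : ℝ → ℂ}

theorem hasDeriv_sub_conj (h : Flow lam a b g) (hq : Flow lam a b q) (ht : t ∈ Icc a b) :
    HasDerivWithinAt (fun t => g t - (starRingEnd ℂ) (q t))
      (-(2 / ((g t - lam t) * (starRingEnd ℂ) (q t - lam t))) * (g t - (starRingEnd ℂ) (q t)))
      (Icc a b) t := by
  have h1 := (h.hasDeriv t ht).sub (HasDerivWithinAt.complex_conj (hq.hasDeriv t ht))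
  have n1 := sub_ofReal_ne_zero (lam t) (h.im_pos t ht)
  have n2 := (map_ne_zero (starRingEnd ℂ)).2 (sub_ofReal_ne_zero (lam t) (hq.im_pos t ht))
  refine h1.congr_deriv ?_
  rw [map_div₀, Complex.conj_ofNat, two_div_sub_two_div n1 n2, ← conj_sub_ofReal,
    sub_sub_sub_cancel_right]

theorem hasDeriv_phase {κ : ℝ → ℝ} {κ' : ℝ} (h : Flow lam a b g) (hq : Flow lam a b q)
    (ht : t ∈ Icc a b) (hne : g t ≠ q t) (hκ : (q t - lam t).re = κ t * (q t - lam t).im)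
    (hd : HasDerivWithinAt κ κ' (Icc a b) t) :
    HasDerivWithinAt (fun t => phase (κ t) (g t) (q t))
      (-((κ' * (Real.log ‖g t - q t‖ - Real.log ‖g t - (starRingEnd ℂ) (q t)‖) : ℝ) : ℂ) *
        Complex.I * phase (κ t) (g t) (q t)) (Icc a b) t := by
  have n1 : g t - q t ≠ 0 := sub_ne_zero.2 hne
  have n2 := sub_conj_ne_zero (h.im_pos t ht) (hq.im_pos t ht)
  have d1 := h.hasDeriv_sub hq ht
  have d2 := h.hasDeriv_sub_conj hq ht
  have l1 := HasDerivWithinAt.log_norm d1 n1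
  have l2 := HasDerivWithinAt.log_norm d2 n2
  have id := im_add_im_eq (z := g t - lam t) (sub_ofReal_ne_zero (lam t) (hq.im_pos t ht)) hκ
  have e1 := HasDerivWithinAt.complex_ofReal (hd.mul (l1.sub l2))
  have e2 := HasDerivWithinAt.complex_ofReal (l1.add l2)
  have key := (d1.mul d2).mul (((e1.neg.mul_const Complex.I).sub e2).cexp)
  refine key.congr_deriv ?_
  generalize hc1 : -(2 / ((g t - lam t) * (q t - lam t))) = c₁ at *
  generalize hc2 : -(2 / ((g t - lam t) * (starRingEnd ℂ) (q t - lam t))) = c₂ at *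
  have id' : c₁ + c₂ - ((κ t * (c₁.re - c₂.re) : ℝ) : ℂ) * Complex.I - ((c₁.re + c₂.re : ℝ) : ℂ) = 0 := by
    rw [← id]
    apply Complex.ext <;> simp
  simp only [phase, Pi.mul_apply, Pi.sub_apply, Pi.add_apply, Pi.neg_apply]
  push_cast at id' ⊢
  linear_combination (g t - q t) * (g t - (starRingEnd ℂ) (q t)) *
    Complex.exp (-(↑(κ t) * (↑(Real.log ‖g t - q t‖) - ↑(Real.log ‖g t - (starRingEnd ℂ) (q t)‖))) *
      Complex.I - (↑(Real.log ‖g t - q t‖) + ↑(Real.log ‖g t - (starRingEnd ℂ) (q t)‖))) * id'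

theorem phase_eq (h : Flow lam a b g) (hq : Flow lam a b q) (hab : a ≤ b)
    (hne : ∀ t ∈ Icc a b, g t ≠ q t)
    (hκ : ∀ t ∈ Icc a b, (q t - lam t).re = κ * (q t - lam t).im) :
    phase κ (g b) (q b) = phase κ (g a) (q a) := by
  have hd : ∀ t ∈ Icc a b, HasDerivWithinAt (fun t => phase κ (g t) (q t)) 0 (Icc a b) t :=
    fun t ht => by
      simpa using h.hasDeriv_phase hq (κ := fun _ => κ) ht (hne t ht) (hκ t ht)
        (hasDerivWithinAt_const _ _ _)
  exact constant_of_has_deriv_right_zero (fun t ht => (hd t ht).continuousWithinAt)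
    (fun t ht => HasDerivWithinAt.Ici_of_Icc (hd t (Ico_subset_Icc_self ht)) ht) b
    (right_mem_Icc.2 hab)

theorem potential_eq (h : Flow lam a b g) (hq : Flow lam a b q) (hab : a ≤ b)
    (hne : ∀ t ∈ Icc a b, g t ≠ q t)
    (hκ : ∀ t ∈ Icc a b, (q t - lam t).re = κ * (q t - lam t).im) :
    potential κ (g b) (q b) = potential κ (g a) (q a) := by
  have hd : ∀ t ∈ Icc a b, HasDerivWithinAt (fun t => potential κ (g t) (q t)) 0 (Icc a b) t :=
    fun t ht => by
      have n1 : g t - q t ≠ 0 := sub_ne_zero.2 (hne t ht)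
      have n2 := sub_conj_ne_zero (h.im_pos t ht) (hq.im_pos t ht)
      have d1 := h.hasDeriv_sub hq ht
      have d2 := h.hasDeriv_sub_conj hq ht
      have l1 := HasDerivWithinAt.log_norm d1 n1
      have l2 := HasDerivWithinAt.log_norm d2 n2
      have l3 := HasDerivWithinAt.complex_im (d2.clog_real
        (Or.inr (sub_conj_im_pos (h.im_pos t ht) (hq.im_pos t ht)).ne'))
      rw [mul_div_cancel_right₀ _ n2] at l3
      simp only [Complex.log_im] at l3
      refine (((l1.const_mul (1 + κ ^ 2)).add (l2.const_mul (1 - κ ^ 2))).sub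
        (l3.const_mul (2 * κ))).congr_deriv ?_
      exact potential_identity (sub_ofReal_ne_zero (lam t) (hq.im_pos t ht)) (hκ t ht)
  exact constant_of_has_deriv_right_zero (fun t ht => (hd t ht).continuousWithinAt)
    (fun t ht => HasDerivWithinAt.Ici_of_Icc (hd t (Ico_subset_Icc_self ht)) ht) b
    (right_mem_Icc.2 hab)

end Flow

theorem abs_mul_arg_le (κ : ℝ) (z : ℂ) : |2 * κ * Complex.arg z| ≤ 2 * |κ| * Real.pi := by
  rw [abs_mul, abs_mul, abs_two]
  gcongr
  exact Complex.abs_arg_le_pi z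

theorem potential_le {p q : ℂ} (κ : ℝ) (hp : 0 < p.im) (hq : 0 < q.im) (hne : p ≠ q) :
    potential κ p q ≤ 2 * Real.log ‖p - (starRingEnd ℂ) q‖ + 2 * |κ| * Real.pi := by
  have h1 : Real.log ‖p - q‖ ≤ Real.log ‖p - (starRingEnd ℂ) q‖ :=
    Real.log_le_log (norm_pos_iff.2 (sub_ne_zero.2 hne)) (norm_sub_le_norm_sub_conj hp hq)
  have h2 := (abs_le.1 (abs_mul_arg_le κ (p - (starRingEnd ℂ) q))).1
  simp only [potential]
  nlinarith [sq_nonneg κ]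

theorem log_norm_sub_le_of_potential {p q : ℂ} (κ : ℝ) (hp : 0 < p.im) (hq : 0 < q.im) :
    (1 + κ ^ 2) * (Real.log ‖p - q‖ - Real.log ‖p - (starRingEnd ℂ) q‖) ≤
      potential κ p q - 2 * Real.log q.im + 2 * |κ| * Real.pi := by
  have h1 : Real.log q.im ≤ Real.log ‖p - (starRingEnd ℂ) q‖ := by
    refine Real.log_le_log hq ?_
    have := (le_abs_self _).trans (Complex.abs_im_le_norm (p - (starRingEnd ℂ) q))
    simp only [Complex.sub_im, Complex.conj_im] at this
    linarith
  have h2 := (abs_le.1 (abs_mul_arg_le κ (p - (starRingEnd ℂ) q))).2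
  simp only [potential]
  nlinarith [sq_nonneg κ]

/-! ### Square root driving functions -/

/-- The flow line captured at time `T` by the driving function `x₀ - 2 * u.re * √(T - t)`. -/
noncomputable def sqrtFlow (x₀ : ℝ) (u : ℂ) (T : ℝ) (t : ℝ) : ℂ := x₀ - (starRingEnd ℂ) u * (√(T - t) : ℝ)

section sqrt

variable {lam : ℝ → ℝ} {e T x₀ : ℝ} {u : ℂ}

theorem sqrtFlow_sub_driver {t : ℝ} (hl : lam t = x₀ - 2 * u.re * √(T - t)) :
    sqrtFlow x₀ u T t - lam t = u * (√(T - t) : ℝ) := by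
  have h := Complex.add_conj u
  rw [sqrtFlow, hl]
  push_cast at h ⊢
  linear_combination (-(√(T - t) : ℂ)) * h

theorem hasDerivWithinAt_sqrt_sub {t : ℝ} (ht : t < T) (s : Set ℝ) :
    HasDerivWithinAt (fun t => √(T - t)) (-(1 / (2 * √(T - t)))) s t := by
  have h := ((hasDerivAt_id t).const_sub T).sqrt (sub_pos.2 ht).ne'
  refine (h.congr_deriv ?_).hasDerivWithinAt
  simp only [id]; ring

theorem flow_sqrtFlow (hl : ∀ t ∈ Icc e T, lam t = x₀ - 2 * u.re * √(T - t)) (hu : 0 < u.im)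
    (hu2 : ‖u‖ = 2) {s : ℝ} (hs : s < T) : Flow lam e s (sqrtFlow x₀ u T) := by
  refine ⟨fun t ht => ?_, fun t ht => ?_⟩
  · have : 0 < √(T - t) := Real.sqrt_pos.2 (by linarith [ht.2])
    simp only [sqrtFlow, Complex.sub_im, Complex.ofReal_im, Complex.im_mul_ofReal, Complex.conj_im]
    nlinarith
  · have hr : 0 < √(T - t) := Real.sqrt_pos.2 (by linarith [ht.2])
    have hr' : ((√(T - t) : ℝ) : ℂ) ≠ 0 := Complex.ofReal_ne_zero.2 hr.ne'
    have hu0 : u ≠ 0 := fun h => by simp [h] at hu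
    have h4 : (starRingEnd ℂ) u * u = 4 := by
      rw [← Complex.normSq_eq_conj_mul_self, Complex.normSq_eq_norm_sq, hu2]; norm_num
    rw [sqrtFlow_sub_driver (hl t ⟨ht.1, by linarith [ht.2]⟩)]
    refine (((HasDerivWithinAt.complex_ofReal (hasDerivWithinAt_sqrt_sub (by linarith [ht.2])
      (Icc e s))).const_mul ((starRingEnd ℂ) u)).const_sub (x₀ : ℂ)).congr_deriv ?_
    push_cast
    field_simp
    linear_combination h4

theorem continuousOn_of_sqrt (hl : ∀ t ∈ Icc e T, lam t = x₀ - 2 * u.re * √(T - t)) :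
    ContinuousOn lam (Icc e T) :=
  ContinuousOn.congr (f := fun t => x₀ - 2 * u.re * √(T - t)) (by fun_prop) hl

theorem captured_sqrtFlow (hl : ∀ t ∈ Icc e T, lam t = x₀ - 2 * u.re * √(T - t)) (heT : e < T)
    (hu : 0 < u.im) (hu2 : ‖u‖ = 2) :
    Captured lam e (sqrtFlow x₀ u T e) T (sqrtFlow x₀ u T) := by
  refine ⟨heT, rfl, fun s hs => flow_sqrtFlow hl hu hu2 hs, ?_⟩
  have h1 : Tendsto (fun s => u * ((√(T - s) : ℝ) : ℂ)) (𝓝[<] T) (𝓝 0) := by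
    have : Continuous fun s => u * ((√(T - s) : ℝ) : ℂ) := by fun_prop
    simpa using (this.tendsto T).mono_left nhdsWithin_le_nhds
  refine h1.congr' ?_
  filter_upwards [Ioo_mem_nhdsLT heT] with s hs
  rw [sqrtFlow_sub_driver (hl s (Ioo_subset_Icc_self hs))]

theorem sqrtFlow_re_eq (hl : ∀ t ∈ Icc e T, lam t = x₀ - 2 * u.re * √(T - t)) (hu : 0 < u.im)
    {t : ℝ} (ht : t ∈ Icc e T) : (sqrtFlow x₀ u T t - lam t).re =
      u.re / u.im * (sqrtFlow x₀ u T t - lam t).im := by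
  rw [sqrtFlow_sub_driver (hl t ht), Complex.re_mul_ofReal, Complex.im_mul_ofReal]
  field_simp

theorem norm_sub_conj_sqrtFlow_le (hl : ∀ t ∈ Icc e T, lam t = x₀ - 2 * u.re * √(T - t))
    (hu2 : ‖u‖ = 2) {t : ℝ} (ht : t ∈ Icc e T) (p : ℂ) :
    ‖p - (starRingEnd ℂ) (sqrtFlow x₀ u T t)‖ ≤ ‖p - lam t‖ + 2 * √(T - t) := by
  have h1 : p - (starRingEnd ℂ) (sqrtFlow x₀ u T t) =
      (p - lam t) - (starRingEnd ℂ) (sqrtFlow x₀ u T t - lam t) := by simp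
  rw [h1]
  refine (norm_sub_le _ _).trans ?_
  rw [Complex.norm_conj, sqrtFlow_sub_driver (hl t ht), norm_mul, hu2, Complex.norm_real,
    Real.norm_of_nonneg (Real.sqrt_nonneg _)]

theorem sqrtFlow_ne {g : ℝ → ℂ} {s : ℝ} (hg : Flow lam e s g)
    (hq : Flow lam e s (sqrtFlow x₀ u T)) {r : ℝ} (hr : r ∈ Icc e s)
    (hne : g r ≠ sqrtFlow x₀ u T r) : ∀ t ∈ Icc e s, g t ≠ sqrtFlow x₀ u T t :=
  fun _ ht h => hne (hg.eqOn hq ht h hr)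

theorem potential_le_of_sqrt (hl : ∀ t ∈ Icc e T, lam t = x₀ - 2 * u.re * √(T - t))
    (hu : 0 < u.im) (hu2 : ‖u‖ = 2) {g : ℝ → ℂ} {s : ℝ} (hes : e ≤ s) (hs : s < T)
    (hg : Flow lam e s g) (hne : g e ≠ sqrtFlow x₀ u T e) :
    potential (u.re / u.im) (g e) (sqrtFlow x₀ u T e) ≤
      2 * Real.log (‖g s - lam s‖ + 2 * √(T - s)) + 2 * |u.re / u.im| * Real.pi := by
  have hq := flow_sqrtFlow hl hu hu2 hs
  have hne' := sqrtFlow_ne hg hq (left_mem_Icc.2 hes) hne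
  have hss := right_mem_Icc.2 hes
  rw [← hg.potential_eq hq hes hne'
    (fun t ht => sqrtFlow_re_eq hl hu ⟨ht.1, ht.2.trans hs.le⟩)]
  refine (potential_le _ (hg.im_pos s hss) (hq.im_pos s hss) (hne' s hss)).trans ?_
  gcongr
  · exact norm_pos_iff.2 (sub_conj_ne_zero (hg.im_pos s hss) (hq.im_pos s hss))
  · exact norm_sub_conj_sqrtFlow_le hl hu2 ⟨hes, hs.le⟩ _

theorem add_two_mul_sqrt_le {x δ M : ℝ} (hδ : 0 < δ) (h1 : δ ≤ 1) (hM : 0 < M)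
    (h2 : δ ≤ (M / 3) ^ 2) {r : ℝ} (hx : x ≤ δ) (hr : r ≤ δ) : x + 2 * √r ≤ M := by
  have h3 : √r ≤ √δ := Real.sqrt_le_sqrt hr
  have h4 : √δ ≤ M / 3 := Real.sqrt_le_iff.2 ⟨by positivity, h2⟩
  have h5 : δ ≤ √δ := Real.le_sqrt_of_sq_le (by nlinarith)
  linarith

theorem captured_sqrt_ne_end (hl : ∀ t ∈ Icc e T, lam t = x₀ - 2 * u.re * √(T - t))
    (hu : 0 < u.im) (hu2 : ‖u‖ = 2) {g : ℝ → ℂ} {z : ℂ} (hg : Captured lam e z T g)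
    (hz : z ≠ sqrtFlow x₀ u T e) : False := by
  set P := potential (u.re / u.im) z (sqrtFlow x₀ u T e) with hP
  set M := Real.exp ((P - 2 * |u.re / u.im| * Real.pi - 1) / 2) with hM
  have hM0 : 0 < M := Real.exp_pos _
  set δ := min 1 ((M / 3) ^ 2) with hδ
  have hδ0 : 0 < δ := by positivity
  obtain ⟨η, hη, ht⟩ := Metric.tendsto_nhdsWithin_nhds.1 hg.tendsto δ hδ0
  have heT := hg.lt
  obtain ⟨m, hm, hmin⟩ := exists_between
    (lt_min (lt_min hη hδ0) (sub_pos.2 heT) : 0 < min (min η δ) (T - e))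
  have m1 : m < η := hmin.trans_le ((min_le_left _ _).trans (min_le_left _ _))
  have m2 : m < δ := hmin.trans_le ((min_le_left _ _).trans (min_le_right _ _))
  have m3 : m < T - e := hmin.trans_le (min_le_right _ _)
  have h1 := ht (show T - m ∈ Iio T from by simp [hm]) (by
    rw [Real.dist_eq, show T - m - T = -m by ring, abs_neg, abs_of_pos hm]; exact m1)
  simp only [dist_zero_right] at h1
  have h2 := potential_le_of_sqrt hl hu hu2 (by linarith) (by linarith : T - m < T)
    (hg.flow _ (by linarith)) (by rw [hg.initial]; exact hz)
  rw [hg.initial, ← hP] at h2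
  have h3 := add_two_mul_sqrt_le hδ0 (min_le_left _ _) hM0 (min_le_right _ _) h1.le
    (by linarith : T - (T - m) ≤ δ)
  have h4 : Real.log (‖g (T - m) - lam (T - m)‖ + 2 * √(T - (T - m))) ≤ Real.log M := by
    refine Real.log_le_log ?_ h3
    have : 0 < √(T - (T - m)) := Real.sqrt_pos.2 (by linarith)
    positivity
  rw [hM, Real.log_exp] at h4
  linarith

/-- A point captured by a square root driving function before the end is in a specific position
relative to the point captured at the end. -/
theorem phase_eq_one_of_captured (hl : ∀ t ∈ Icc e T, lam t = x₀ - 2 * u.re * √(T - t))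
    (hu : 0 < u.im) (hu2 : ‖u‖ = 2) {g : ℝ → ℂ} {z : ℂ} {T' : ℝ} (hg : Captured lam e z T' g)
    (hT' : T' ≤ T) (hz : z ≠ sqrtFlow x₀ u T e) :
    phase (u.re / u.im) z (sqrtFlow x₀ u T e) = 1 := by
  rcases hT'.eq_or_lt with rfl | hlt
  · exact (captured_sqrt_ne_end hl hu hu2 hg hz).elim
  have heT := hg.lt
  set q := sqrtFlow x₀ u T with hq
  set κ := u.re / u.im
  have hmem : T' ∈ Icc e T := ⟨heT.le, hT'⟩
  have hqT' := flow_sqrtFlow hl hu hu2 hlt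
  have hqc : Continuous q := by unfold q sqrtFlow; fun_prop
  have hlc : Tendsto lam (𝓝[<] T') (𝓝 (lam T')) := by
    refine ((continuousOn_of_sqrt hl).continuousWithinAt hmem).mono_left ?_
    rw [← nhdsWithin_Ioo_eq_nhdsLT heT]
    exact nhdsWithin_mono _ fun s hs => ⟨hs.1.le, hs.2.le.trans hT'⟩
  have hgc : Tendsto g (𝓝[<] T') (𝓝 (lam T' : ℂ)) := by
    have := hg.tendsto.add ((Complex.continuous_ofReal.tendsto _).comp hlc)
    simpa using this
  have hqt : Tendsto q (𝓝[<] T') (𝓝 (q T')) := (hqc.tendsto _).mono_left nhdsWithin_le_nhds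
  have hqim : 0 < (q T').im := hqT'.im_pos T' ⟨heT.le, le_rfl⟩
  set w := q T' - lam T' with hw
  have hw0 : w ≠ 0 := sub_ofReal_ne_zero _ hqim
  have hw0' : (starRingEnd ℂ) w ≠ 0 := (map_ne_zero _).2 hw0
  have t1 : Tendsto (fun s => g s - q s) (𝓝[<] T') (𝓝 (-w)) := by
    have := hgc.sub hqt
    rwa [show (lam T' : ℂ) - q T' = -w by rw [hw]; ring] at this
  have t2 : Tendsto (fun s => g s - (starRingEnd ℂ) (q s)) (𝓝[<] T')
      (𝓝 (-(starRingEnd ℂ) w)) := by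
    have := hgc.sub ((Complex.continuous_conj.tendsto _).comp hqt)
    rwa [show (lam T' : ℂ) - (starRingEnd ℂ) (q T') = -(starRingEnd ℂ) w by rw [hw]; simp] at this
  have l1 := t1.norm.log (norm_ne_zero_iff.2 (neg_ne_zero.2 hw0))
  have l2 := t2.norm.log (norm_ne_zero_iff.2 (neg_ne_zero.2 hw0'))
  rw [norm_neg] at l1
  rw [norm_neg, Complex.norm_conj] at l2
  have key : Tendsto (fun s => phase κ (g s) (q s)) (𝓝[<] T')
      (𝓝 (-w * -(starRingEnd ℂ) w * Complex.exp
        (-((κ * (Real.log ‖w‖ - Real.log ‖w‖) : ℝ) : ℂ) * Complex.I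
          - ((Real.log ‖w‖ + Real.log ‖w‖ : ℝ) : ℂ)))) := by
    refine (t1.mul t2).mul ((Complex.continuous_exp.tendsto _).comp ?_)
    refine Tendsto.sub (Tendsto.mul_const _ (Tendsto.neg ?_)) ?_
    · exact (Complex.continuous_ofReal.tendsto _).comp ((l1.sub l2).const_mul κ)
    · exact (Complex.continuous_ofReal.tendsto _).comp (l1.add l2)
  have hlim : -w * -(starRingEnd ℂ) w * Complex.exp
        (-((κ * (Real.log ‖w‖ - Real.log ‖w‖) : ℝ) : ℂ) * Complex.I
          - ((Real.log ‖w‖ + Real.log ‖w‖ : ℝ) : ℂ)) = 1 := by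
    have hpos : 0 < ‖w‖ := norm_pos_iff.2 hw0
    rw [sub_self, mul_zero, Complex.ofReal_zero, neg_zero, zero_mul, zero_sub, neg_mul_neg,
      Complex.mul_conj, Complex.normSq_eq_norm_sq, ← Complex.ofReal_neg, ← Complex.ofReal_exp,
      ← Complex.ofReal_mul, neg_add, Real.exp_add, Real.exp_neg, Real.exp_log hpos]
    norm_cast
    field_simp
  rw [hlim] at key
  have hconst : ∀ s ∈ Ioo e T', phase κ (g s) (q s) = phase κ z (q e) := by
    intro s hs
    have hgs := hg.flow s hs.2
    have hqs := hqT'.mono le_rfl hs.2.le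
    have hne := sqrtFlow_ne hgs hqs (left_mem_Icc.2 hs.1.le) (by rw [hg.initial]; exact hz)
    rw [hgs.phase_eq hqs hs.1.le hne
      (fun t ht => sqrtFlow_re_eq hl hu ⟨ht.1, (ht.2.trans hs.2.le).trans hT'⟩), hg.initial]
  refine tendsto_nhds_unique (tendsto_const_nhds.congr' ?_) key
  filter_upwards [Ioo_mem_nhdsLT heT] with s hs
  exact (hconst s hs).symm

theorem localLeft_sqrt (he : 0 ≤ e) (heT : e < T)
    (hl : ∀ t ∈ Icc e T, lam t = x₀ - 2 * u.re * √(T - t)) (hu : 0 < u.im) (hu2 : ‖u‖ = 2) :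
    LocalLeft lam T := by
  set q := sqrtFlow x₀ u T with hq
  set κ := u.re / u.im with hκ
  have hy : 0 < (q e).im := (flow_sqrtFlow hl hu hu2 heT).im_pos e ⟨le_rfl, le_rfl⟩
  set y := (q e).im with hydef
  have main : ∀ ε > 0, ∃ δ > 0, ∀ t ∈ Ioo e T, T - t < δ → ∀ g, Flow lam e t g →
      ‖g t - lam t‖ < δ → ‖g e - q e‖ < ε := by
    intro ε hε
    set η := min (1 / 2) (ε / (8 * y)) with hη
    have hη0 : 0 < η := by positivity
    set M := Real.exp (((1 + κ ^ 2) * Real.log η - 4 * |κ| * Real.pi + 2 * Real.log y) / 2) with hM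
    have hM0 : 0 < M := Real.exp_pos _
    refine ⟨min 1 ((M / 3) ^ 2), by positivity, fun t ht htT g hg hgt => ?_⟩
    have htm := right_mem_Icc.2 ht.1.le
    have hem := left_mem_Icc.2 ht.1.le
    rcases eq_or_ne (g e) (q e) with heq | hne
    · simpa [heq] using hε
    have h1 := potential_le_of_sqrt hl hu hu2 ht.1.le ht.2 hg hne
    have h2 := log_norm_sub_le_of_potential κ (hg.im_pos e hem) hy
    have h3 : Real.log (‖g t - lam t‖ + 2 * √(T - t)) ≤ Real.log M := by
      refine Real.log_le_log ?_ (add_two_mul_sqrt_le (δ := min 1 ((M / 3) ^ 2)) (by positivity)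
        (min_le_left _ _) hM0 (min_le_right _ _) hgt.le htT.le)
      have : 0 < √(T - t) := Real.sqrt_pos.2 (by linarith [ht.2])
      positivity
    rw [hM, Real.log_exp] at h3
    have h4 : (1 + κ ^ 2) * (Real.log ‖g e - q e‖ - Real.log ‖g e - (starRingEnd ℂ) (q e)‖) ≤
        (1 + κ ^ 2) * Real.log η := by linarith
    have h5 := le_of_mul_le_mul_left h4 (by positivity)
    have n1 : 0 < ‖g e - q e‖ := norm_pos_iff.2 (sub_ne_zero.2 hne)
    have n2 : 0 < ‖g e - (starRingEnd ℂ) (q e)‖ :=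
      norm_pos_iff.2 (sub_conj_ne_zero (hg.im_pos e hem) hy)
    rw [← Real.log_div n1.ne' n2.ne'] at h5
    have h6 := (Real.log_le_log_iff (by positivity) hη0).1 h5
    rw [div_le_iff₀ n2] at h6
    have h7 : ‖g e - (starRingEnd ℂ) (q e)‖ ≤ ‖g e - q e‖ + 2 * y := by
      have : g e - (starRingEnd ℂ) (q e) = (g e - q e) + (q e - (starRingEnd ℂ) (q e)) := by ring
      rw [this]
      refine (norm_add_le _ _).trans ?_
      rw [Complex.sub_conj, norm_mul, Complex.norm_I, mul_one, Complex.norm_real, Real.norm_eq_abs,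
        abs_of_pos (by positivity)]
    have e1 : η ≤ 1 / 2 := min_le_left _ _
    have e2 : η * (8 * y) ≤ ε := by
      rw [← le_div_iff₀ (by positivity)]; exact min_le_right _ _
    nlinarith
  have main' : ∀ ε > 0, ∃ δ > 0, ∀ t ∈ Ioc e T, T - t < δ → ∀ g, Flow lam e t g →
      ‖g t - lam t‖ < δ → ‖g e - q e‖ < ε := by
    intro ε hε
    obtain ⟨δ, hδ, h⟩ := main ε hε
    refine ⟨δ, hδ, fun t ht htT g hg hgt => ?_⟩
    rcases ht.2.lt_or_eq with hlt | rfl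
    · exact h t ⟨ht.1, hlt⟩ htT g hg hgt
    have hcont : ContinuousWithinAt (fun s => ‖g s - lam s‖) (Icc e t) t :=
      ((hg.continuousOn.sub (Complex.continuous_ofReal.comp_continuousOn
        (continuousOn_of_sqrt hl))).norm) t ⟨ht.1.le, le_rfl⟩
    have hcont' : Tendsto (fun s => ‖g s - lam s‖) (𝓝[<] t) (𝓝 ‖g t - lam t‖) := by
      refine hcont.mono_left ?_
      rw [← nhdsWithin_Ioo_eq_nhdsLT heT]
      exact nhdsWithin_mono _ Ioo_subset_Icc_self
    have e1 : ∀ᶠ s in 𝓝[<] t, s ∈ Ioo e t := Ioo_mem_nhdsLT heT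
    have e2 : ∀ᶠ s in 𝓝[<] t, s ∈ Ioo (t - δ) t := Ioo_mem_nhdsLT (sub_lt_self t hδ)
    obtain ⟨s, h1, h2, h3⟩ := ((hcont'.eventually (gt_mem_nhds hgt)).and (e1.and e2)).exists
    exact h s h2 (by linarith [h3.1]) g (hg.mono le_rfl h2.2.le) h1
  refine ⟨e, he, heT, y / 2, half_pos hy, fun ε hε => ?_⟩
  obtain ⟨δ, hδ, h⟩ := main' (min (ε / 2) (y / 2)) (by positivity)
  refine ⟨δ, hδ, fun t ht htT g g' hg hg' h1 h2 => ?_⟩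
  have k1 := h t ht htT g hg h1
  have k2 := h t ht htT g' hg' h2
  constructor
  · have := norm_sub_le (g e - q e) (g' e - q e)
    rw [sub_sub_sub_cancel_right] at this
    linarith [min_le_left (ε / 2) (y / 2)]
  · have := (Complex.abs_im_le_norm (g e - q e)).trans k1.le
    rw [Complex.sub_im] at this
    linarith [neg_abs_le ((g e).im - (q e).im), min_le_right (ε / 2) (y / 2)]

end sqrt


/-! ### Linear driving functions -/

section linear

variable {lam : ℝ → ℝ} {a b T x₀ : ℝ} {z : ℂ} {g q : ℝ → ℂ}

theorem Flow.hasDeriv_sub_linear {c t : ℝ} (hl : ∀ t ∈ Icc a c, lam t = x₀ + b * (t - a))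
    (h : Flow lam a c g) (ht : t ∈ Icc a c) :
    HasDerivWithinAt (fun t => g t - lam t) (2 / (g t - lam t) - b) (Icc a c) t := by
  have h1 : HasDerivWithinAt (fun t => x₀ + b * (t - a)) b (Icc a c) t := by
    simpa using ((((hasDerivAt_id t).sub_const a).const_mul b).const_add x₀).hasDerivWithinAt
  exact (h.hasDeriv t ht).sub (HasDerivWithinAt.complex_ofReal (h1.congr_of_mem hl ht))

theorem Captured.linear_im_add_arg (hl : ∀ t ∈ Icc a T, lam t = x₀ + b * (t - a)) (hb : b ≠ 0)
    (hg : Captured lam a z T g) :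
    (z - x₀).im + 2 / b * Complex.arg (1 - (b / 2 : ℝ) * (z - x₀)) = 0 := by
  have haT := hg.lt
  have hb' : (b : ℂ) ≠ 0 := Complex.ofReal_ne_zero.2 hb
  set I : ℝ → ℝ := fun t => ((g t - lam t) +
    (2 / b : ℝ) * Complex.log (1 - (b / 2 : ℝ) * (g t - lam t))).im with hI
  have hconst : ∀ s ∈ Ioo a T, I s = I a := by
    intro s hs
    have hf := hg.flow s hs.2
    have hd : ∀ t ∈ Icc a s, HasDerivWithinAt I 0 (Icc a s) t := by
      intro t ht
      have hZ := hf.hasDeriv_sub_linear (fun r hr => hl r ⟨hr.1, hr.2.trans hs.2.le⟩) ht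
      have hY := hf.im_pos t ht
      have hne := sub_ofReal_ne_zero (lam t) hY
      have him : (1 - (b / 2 : ℝ) * (g t - lam t)).im ≠ 0 := by
        rw [Complex.sub_im, Complex.im_ofReal_mul, sub_ofReal_im, Complex.one_im, zero_sub]
        exact neg_ne_zero.2 (mul_ne_zero (div_ne_zero hb two_ne_zero) hY.ne')
      have hne2 : 1 - (b / 2 : ℝ) * (g t - lam t) ≠ 0 := fun h => him (by rw [h]; rfl)
      have h1 := HasDerivWithinAt.complex_im (hZ.add (((hZ.const_mul ((b / 2 : ℝ) : ℂ)).const_sub 1).clog_real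
        (Or.inr him) |>.const_mul ((2 / b : ℝ) : ℂ)))
      refine h1.congr_deriv ?_
      have h2 : 2 / (g t - lam t) - b + ((2 / b : ℝ) : ℂ) *
          (-(((b / 2 : ℝ) : ℂ) * (2 / (g t - lam t) - b)) / (1 - ((b / 2 : ℝ) : ℂ) * (g t - lam t)))
          = ((-b : ℝ) : ℂ) := by
        generalize g t - lam t = Z at hne hne2 ⊢
        have hne3 : (2 : ℂ) - b * Z ≠ 0 := fun h => hne2 (by
          push_cast; linear_combination h / 2)
        have h3 : (1 : ℂ) - ((b / 2 : ℝ) : ℂ) * Z = (2 - b * Z) / 2 := by push_cast; ring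
        rw [h3]
        generalize hD : (2 : ℂ) - b * Z = D at hne3 ⊢
        push_cast
        field_simp
        linear_combination (-2 : ℂ) * hD
      rw [h2, Complex.ofReal_im]
    exact constant_of_has_deriv_right_zero (fun t ht => (hd t ht).continuousWithinAt)
      (fun t ht => HasDerivWithinAt.Ici_of_Icc (hd t (Ico_subset_Icc_self ht)) ht) s
      (right_mem_Icc.2 hs.1.le)
  have hlim : Tendsto I (𝓝[<] T) (𝓝 0) := by
    have h1 : Tendsto (fun s => 1 - (b / 2 : ℝ) * (g s - lam s)) (𝓝[<] T) (𝓝 1) := by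
      simpa using (hg.tendsto.const_mul ((b / 2 : ℝ) : ℂ)).const_sub 1
    have h2 := hg.tendsto.add ((h1.clog (by simp)).const_mul ((2 / b : ℝ) : ℂ))
    have h3 := (Complex.continuous_im.tendsto _).comp h2
    rw [Complex.log_one, mul_zero, add_zero, Complex.zero_im] at h3
    exact h3
  have hIa : I a = 0 := by
    refine tendsto_nhds_unique (tendsto_const_nhds.congr' ?_) hlim
    filter_upwards [Ioo_mem_nhdsLT haT] with s hs
    exact (hconst s hs).symm
  have hla : lam a = x₀ := by simpa using hl a ⟨le_rfl, haT.le⟩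
  rw [← hIa, hI]
  simp only [hg.initial, hla]
  rw [Complex.add_im, Complex.im_ofReal_mul, Complex.log_im]

theorem Captured.linear_slope (hl : ∀ t ∈ Icc a T, lam t = x₀ + b * (t - a)) (hb : b ≠ 0)
    (hz : 0 < z.im) (hg : Captured lam a z T g) :
    (1 - b / 2 * (z - x₀).re) * Real.sin (b / 2 * z.im) =
      b / 2 * z.im * Real.cos (b / 2 * z.im) ∧ |b / 2 * z.im| < Real.pi := by
  have h := hg.linear_im_add_arg hl hb
  set W := 1 - ((b / 2 : ℝ) : ℂ) * (z - x₀) with hW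
  have harg : Complex.arg W = -(b / 2 * z.im) := by
    rw [sub_ofReal_im] at h
    field_simp at h ⊢
    linarith
  have hre : W.re = 1 - b / 2 * (z - x₀).re := by
    rw [hW, Complex.sub_re, Complex.re_ofReal_mul, Complex.one_re]
  have him : W.im = -(b / 2 * z.im) := by
    rw [hW, Complex.sub_im, Complex.im_ofReal_mul, Complex.one_im, sub_ofReal_im, zero_sub]
  have h1 := Complex.norm_mul_cos_arg W
  have h2 := Complex.norm_mul_sin_arg W
  rw [harg, Real.cos_neg, hre] at h1
  rw [harg, Real.sin_neg, him] at h2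
  refine ⟨?_, ?_⟩
  · rw [← h1]
    linear_combination (-Real.cos (b / 2 * z.im)) * h2
  · rw [← abs_neg, ← harg, abs_lt]
    refine ⟨Complex.neg_pi_lt_arg _, Complex.arg_lt_pi_iff.2 (Or.inr ?_)⟩
    rw [him]
    exact neg_ne_zero.2 (mul_ne_zero (div_ne_zero hb two_ne_zero) hz.ne')

end linear

theorem strictMonoOn_inv_sub_cot :
    StrictMonoOn (fun x => 1 / x - Real.cos x / Real.sin x) (Ioo 0 Real.pi) := by
  refine strictMonoOn_of_hasDerivWithinAt_pos (convex_Ioo _ _)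
    (f' := fun x => -(1 / x ^ 2) + 1 / Real.sin x ^ 2) (fun x hx => ?_) (fun x hx => ?_)
    (fun x hx => ?_)
  · have hs := Real.sin_pos_of_mem_Ioo hx
    exact (((continuousAt_const.div continuousAt_id hx.1.ne').sub
      (Real.continuous_cos.continuousAt.div Real.continuous_sin.continuousAt
        hs.ne'))).continuousWithinAt
  · rw [interior_Ioo] at hx ⊢
    have hs := Real.sin_pos_of_mem_Ioo hx
    have h1 := ((hasDerivAt_inv hx.1.ne').sub
      ((Real.hasDerivAt_cos x).div (Real.hasDerivAt_sin x) hs.ne')).hasDerivWithinAt (s := Ioo 0 Real.pi)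
    simp only [one_div]
    refine h1.congr_deriv ?_
    have := Real.sin_sq_add_cos_sq x
    have h0 := hx.1.ne'
    have h2 : -Real.sin x * Real.sin x - Real.cos x * Real.cos x = -1 := by linear_combination -this
    rw [h2]
    field_simp
    ring
  · rw [interior_Ioo] at hx
    have hs := Real.sin_pos_of_mem_Ioo hx
    have h1 : Real.sin x < x := Real.sin_lt hx.1
    have h2 : 1 / x ^ 2 < 1 / Real.sin x ^ 2 := by gcongr
    linarith

theorem eq_of_slope_equation {X Y b₁ b₂ : ℝ} (hY : 0 < Y) (hb : 0 < b₁ * b₂)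
    (h₁ : (1 - b₁ / 2 * X) * Real.sin (b₁ / 2 * Y) = b₁ / 2 * Y * Real.cos (b₁ / 2 * Y) ∧
      |b₁ / 2 * Y| < Real.pi)
    (h₂ : (1 - b₂ / 2 * X) * Real.sin (b₂ / 2 * Y) = b₂ / 2 * Y * Real.cos (b₂ / 2 * Y) ∧
      |b₂ / 2 * Y| < Real.pi) : b₁ = b₂ := by
  have key : ∀ (X b : ℝ), 0 < b →
      (1 - b / 2 * X) * Real.sin (b / 2 * Y) = b / 2 * Y * Real.cos (b / 2 * Y) ∧
      |b / 2 * Y| < Real.pi → b / 2 * Y ∈ Ioo 0 Real.pi ∧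
      1 / (b / 2 * Y) - Real.cos (b / 2 * Y) / Real.sin (b / 2 * Y) = X / Y := by
    intro X b hb h
    have hmem : b / 2 * Y ∈ Ioo 0 Real.pi := ⟨by positivity, (abs_lt.1 h.2).2⟩
    have hs := Real.sin_pos_of_mem_Ioo hmem
    refine ⟨hmem, ?_⟩
    rw [div_sub_div _ _ hmem.1.ne' hs.ne', div_eq_div_iff (mul_pos hmem.1 hs).ne' hY.ne']
    linear_combination Y * h.1
  have pos : ∀ (X b₁ b₂ : ℝ), 0 < b₁ → 0 < b₂ →
      ((1 - b₁ / 2 * X) * Real.sin (b₁ / 2 * Y) = b₁ / 2 * Y * Real.cos (b₁ / 2 * Y) ∧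
        |b₁ / 2 * Y| < Real.pi) →
      ((1 - b₂ / 2 * X) * Real.sin (b₂ / 2 * Y) = b₂ / 2 * Y * Real.cos (b₂ / 2 * Y) ∧
        |b₂ / 2 * Y| < Real.pi) → b₁ = b₂ := by
    intro X b₁ b₂ hb₁ hb₂ h₁ h₂
    obtain ⟨m1, e1⟩ := key X b₁ hb₁ h₁
    obtain ⟨m2, e2⟩ := key X b₂ hb₂ h₂
    have := strictMonoOn_inv_sub_cot.injOn m1 m2 (e1.trans e2.symm)
    have := mul_right_cancel₀ hY.ne' this
    linarith
  have refl : ∀ b : ℝ,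
      ((1 - b / 2 * X) * Real.sin (b / 2 * Y) = b / 2 * Y * Real.cos (b / 2 * Y) ∧
        |b / 2 * Y| < Real.pi) →
      ((1 - -b / 2 * -X) * Real.sin (-b / 2 * Y) = -b / 2 * Y * Real.cos (-b / 2 * Y) ∧
        |-b / 2 * Y| < Real.pi) := by
    intro b h
    rw [show -b / 2 * Y = -(b / 2 * Y) by ring, Real.sin_neg, Real.cos_neg, abs_neg]
    exact ⟨by linear_combination -h.1, h.2⟩
  rcases pos_and_pos_or_neg_and_neg_of_mul_pos hb with ⟨p1, p2⟩ | ⟨p1, p2⟩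
  · exact pos X b₁ b₂ p1 p2 h₁ h₂
  · have := pos (-X) (-b₁) (-b₂) (by linarith) (by linarith) (refl b₁ h₁) (refl b₂ h₂)
    linarith

/-! ### The waiting phase -/

section waiting

variable {lam : ℝ → ℝ} {a b c x₀ : ℝ} {g q : ℝ → ℂ}

theorem Flow.mul_re_nonpos (hl : ∀ t ∈ Icc a c, lam t = x₀ + b * (t - a)) (hb : b ≠ 0)
    (h : Flow lam a c q) (h0 : b * (q a - lam a).re ≤ 0) :
    ∀ t ∈ Icc a c, b * (q t - lam t).re ≤ 0 := by
  have hd : ∀ t ∈ Icc a c, HasDerivWithinAt (fun t => b * (q t - lam t).re)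
      (b * (2 / (q t - lam t) - b).re) (Icc a c) t := fun t ht =>
    (HasDerivWithinAt.complex_re (h.hasDeriv_sub_linear hl ht)).const_mul b
  refine image_le_of_deriv_right_lt_deriv_boundary' (B := fun _ => 0) (B' := fun _ => 0)
    (fun t ht => (hd t ht).continuousWithinAt)
    (fun t ht => HasDerivWithinAt.Ici_of_Icc (hd t (Ico_subset_Icc_self ht)) ht) h0
    continuousOn_const (fun _ _ => hasDerivWithinAt_const _ _ _) fun t ht heq => ?_
  rw [Complex.sub_re, two_div_re, Complex.ofReal_re, mul_sub]
  have : b * (2 * (q t - lam t).re / Complex.normSq (q t - lam t)) = 0 := by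
    rw [← mul_div_assoc, mul_left_comm, heq]; simp
  rw [this]
  have := mul_self_pos.2 hb
  linarith

theorem Flow.norm_sub_sq_le_linear {R : ℝ} (hl : ∀ t ∈ Icc a c, lam t = x₀ + b * (t - a))
    (h : Flow lam a c q) (hR : 0 ≤ R) (hbR : |b| * R ≤ 1)
    (hRc : ‖q a - lam a‖ ^ 2 + 7 * (c - a) ≤ R ^ 2) :
    ∀ t ∈ Icc a c, ‖q t - lam t‖ ^ 2 ≤ ‖q a - lam a‖ ^ 2 + 7 * (t - a) := by
  have hd := fun t ht => (h.hasDeriv_sub_linear hl ht (t := t)).norm_sq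
  refine image_le_of_deriv_right_lt_deriv_boundary' (B' := fun _ => 7)
    (fun t ht => (hd t ht).continuousWithinAt)
    (fun t ht => HasDerivWithinAt.Ici_of_Icc (hd t (Ico_subset_Icc_self ht)) ht) (by simp)
    (by fun_prop) (fun t _ => by
      simpa using ((((hasDerivAt_id t).sub_const a).const_mul 7).const_add
        (‖q a - lam a‖ ^ 2)).hasDerivWithinAt) fun t ht heq => ?_
  have hne := sub_ofReal_ne_zero (lam t) (h.im_pos t (Ico_subset_Icc_self ht))
  set Z := q t - lam t
  have hZR : ‖Z‖ ≤ R := le_of_sq_le_sq (by rw [heq]; linarith [ht.2]) hR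
  have hn : 0 < ‖Z‖ := norm_pos_iff.2 hne
  have h1 : inner ℝ Z (2 / Z - b) ≤ ‖Z‖ * (2 / ‖Z‖ + |b|) := by
    refine (real_inner_le_norm _ _).trans ?_
    gcongr
    refine (norm_sub_le _ _).trans ?_
    rw [norm_div, Complex.norm_ofNat, Complex.norm_real, Real.norm_eq_abs]
  have h2 : ‖Z‖ * (2 / ‖Z‖ + |b|) = 2 + |b| * ‖Z‖ := by field_simp
  have h3 : |b| * ‖Z‖ ≤ |b| * R := by gcongr
  linarith

theorem Flow.hasDeriv_re_div_im {t : ℝ} (hl : ∀ t ∈ Icc a c, lam t = x₀ + b * (t - a))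
    (h : Flow lam a c q) (ht : t ∈ Icc a c) :
    HasDerivWithinAt (fun t => (q t - lam t).re / (q t - lam t).im)
      ((4 * (q t - lam t).re / Complex.normSq (q t - lam t) - b) / (q t - lam t).im)
      (Icc a c) t := by
  have hd := h.hasDeriv_sub_linear hl ht
  have hY : (q t - lam t).im ≠ 0 := by rw [sub_ofReal_im]; exact (h.im_pos t ht).ne'
  refine ((HasDerivWithinAt.complex_re hd).div (HasDerivWithinAt.complex_im hd) hY).congr_deriv ?_
  rw [Complex.sub_re, Complex.sub_im (2 / (q t - lam t)), two_div_re, two_div_im, Complex.ofReal_re,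
    Complex.ofReal_im]
  have hn : Complex.normSq (q t - lam t) ≠ 0 :=
    Complex.normSq_eq_zero.not.2 (sub_ofReal_ne_zero _ (h.im_pos t ht))
  field_simp
  ring

theorem countable_of_hasDerivAt_ne_zero {f f' : ℝ → ℂ} {S : Set ℝ} {w : ℂ}
    (hd : ∀ x ∈ S, HasDerivAt f (f' x) x) (h0 : ∀ x ∈ S, f' x ≠ 0) (hS : ∀ x ∈ S, f x = w) :
    S.Countable := by
  refine (HereditarilyLindelofSpace.isLindelof S).countable_of_isDiscrete ?_
  rw [isDiscrete_iff_nhdsNE]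
  intro x hx
  rw [← disjoint_iff, Filter.disjoint_principal_right]
  filter_upwards [(hd x hx).eventually_ne (h0 x hx) (c := w)] with y hy hyS
  exact hy (hS y hyS)

theorem phase_ne_zero {p q : ℂ} (κ : ℝ) (hp : 0 < p.im) (hq : 0 < q.im) (hne : p ≠ q) :
    phase κ p q ≠ 0 :=
  mul_ne_zero (mul_ne_zero (sub_ne_zero.2 hne) (sub_conj_ne_zero hp hq)) (Complex.exp_ne_zero _)

theorem norm_sub_lt_norm_sub_conj {p q : ℂ} (hp : 0 < p.im) (hq : 0 < q.im) :
    ‖p - q‖ < ‖p - (starRingEnd ℂ) q‖ := by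
  refine lt_of_pow_lt_pow_left₀ 2 (norm_nonneg _) ?_
  rw [← Complex.normSq_eq_norm_sq, ← Complex.normSq_eq_norm_sq, Complex.normSq_apply,
    Complex.normSq_apply]
  simp only [Complex.sub_re, Complex.sub_im, Complex.conj_re, Complex.conj_im]
  nlinarith [mul_pos hp hq]

theorem Flow.countable_phase_eq_one (hl : ∀ t ∈ Icc a c, lam t = x₀ + b * (t - a)) (hb : b ≠ 0)
    (hg : Flow lam a c g) (hq : Flow lam a c q) (h0 : b * (q a - lam a).re ≤ 0)
    (hne : g a ≠ q a) :
    {t ∈ Ioo a c | phase ((q t - lam t).re / (q t - lam t).im) (g t) (q t) = 1}.Countable := by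
  have hne' : ∀ t ∈ Icc a c, g t ≠ q t := fun t ht h =>
    hne (hg.eqOn hq ht h (left_mem_Icc.2 (ht.1.trans ht.2)))
  refine countable_of_hasDerivAt_ne_zero (w := 1)
    (f := fun t => phase ((q t - lam t).re / (q t - lam t).im) (g t) (q t))
    (f' := fun t => -(((4 * (q t - lam t).re / Complex.normSq (q t - lam t) - b) / (q t - lam t).im *
      (Real.log ‖g t - q t‖ - Real.log ‖g t - (starRingEnd ℂ) (q t)‖) : ℝ) : ℂ) *
        Complex.I * phase ((q t - lam t).re / (q t - lam t).im) (g t) (q t))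
    (fun t ht => ?_) (fun t ht => ?_) (fun t ht => ht.2)
  · have ht' := Ioo_subset_Icc_self ht.1
    have hY : (q t - lam t).im ≠ 0 := by rw [sub_ofReal_im]; exact (hq.im_pos t ht').ne'
    exact (hg.hasDeriv_phase hq ht' (hne' t ht') (div_mul_cancel₀ _ hY).symm
      (hq.hasDeriv_re_div_im hl ht')).hasDerivAt (Icc_mem_nhds ht.1.1 ht.1.2)
  · have ht' := Ioo_subset_Icc_self ht.1
    have hpg := hg.im_pos t ht'
    have hpq := hq.im_pos t ht'
    have hY : (q t - lam t).im ≠ 0 := by rw [sub_ofReal_im]; exact hpq.ne'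
    have hn : 0 < Complex.normSq (q t - lam t) :=
      Complex.normSq_pos.2 (sub_ofReal_ne_zero _ hpq)
    have hX := hq.mul_re_nonpos hl hb h0 t ht'
    refine mul_ne_zero (mul_ne_zero (neg_ne_zero.2 (Complex.ofReal_ne_zero.2 (mul_ne_zero
      (div_ne_zero ?_ hY) ?_))) Complex.I_ne_zero) (phase_ne_zero _ hpg hpq (hne' t ht'))
    · intro h
      have h1 : b * (4 * (q t - lam t).re / Complex.normSq (q t - lam t) - b) = 0 := by rw [h, mul_zero]
      have h2 : b * (4 * (q t - lam t).re / Complex.normSq (q t - lam t) - b) =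
        4 * (b * (q t - lam t).re) / Complex.normSq (q t - lam t) - b * b := by ring
      have h3 : 4 * (b * (q t - lam t).re) / Complex.normSq (q t - lam t) ≤ 0 :=
        div_nonpos_of_nonpos_of_nonneg (by linarith) hn.le
      have := mul_self_pos.2 hb
      linarith
    · refine (sub_neg.2 (Real.log_lt_log (norm_pos_iff.2 (sub_ne_zero.2 (hne' t ht'))) ?_)).ne
      exact norm_sub_lt_norm_sub_conj hpg hpq

end waiting


/-! ### Concatenation of driving functions -/

theorem Flow.captured_glue {lam : ℝ → ℝ} {a e T : ℝ} {g₁ g₂ : ℝ → ℂ} (h₁ : Flow lam a e g₁)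
    (hae : a ≤ e) (h₂ : Captured lam e (g₁ e) T g₂) : ∃ g, Captured lam a (g₁ a) T g := by
  refine ⟨fun t => if t ≤ e then g₁ t else g₂ t, hae.trans_lt h₂.lt, by simp [hae],
    fun s hs => ?_, ?_⟩
  · rcases le_total s e with hse | hse
    · exact (h₁.mono le_rfl hse).congr fun t ht => by simp [ht.2.trans hse]
    · exact h₁.glue (h₂.flow s hs) h₂.initial.symm hae hse
  · refine h₂.tendsto.congr' ?_
    filter_upwards [Ioo_mem_nhdsLT h₂.lt] with s hs
    simp [not_le.2 hs.1]

theorem Flow.alive_glue {lam : ℝ → ℝ} {a e T : ℝ} {g₁ : ℝ → ℂ} (h₁ : Flow lam a e g₁)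
    (hae : a ≤ e) (heT : e ≤ T) (h₂ : Alive lam e T (g₁ e)) : Alive lam a T (g₁ a) := by
  obtain ⟨g₂, h₂, h0⟩ := h₂
  exact ⟨_, h₁.glue h₂ h0.symm hae heT, by simp [hae]⟩

theorem Captured.congr_driver {lam lam' : ℝ → ℝ} {a T : ℝ} {z : ℂ} {g : ℝ → ℂ}
    (h : Captured lam a z T g) (hl : EqOn lam' lam (Icc a T)) : Captured lam' a z T g := by
  refine ⟨h.lt, h.initial, fun s hs => (h.flow s hs).congr_driver
    (hl.mono (Icc_subset_Icc_right hs.le)), h.tendsto.congr' ?_⟩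
  filter_upwards [Ioo_mem_nhdsLT h.lt] with s hs
  rw [hl (Ioo_subset_Icc_self hs)]

/-- `lam` up to time `a`, then linear with slope `b` up to time `e`, then a square root. -/
noncomputable def extendDriver (lam : ℝ → ℝ) (a b e T c : ℝ) (t : ℝ) : ℝ :=
  if t ≤ a then lam t else if t ≤ e then lam a + b * (t - a)
    else lam a + b * (e - a) + c * √(T - e) - c * √(T - t)

section extend

variable {lam : ℝ → ℝ} {a b e T c : ℝ}

theorem extendDriver_of_le {t : ℝ} (h : t ≤ a) : extendDriver lam a b e T c t = lam t := by
  simp [extendDriver, h]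

theorem extendDriver_of_mem_left {t : ℝ} (h : t ∈ Icc a e) :
    extendDriver lam a b e T c t = lam a + b * (t - a) := by
  rcases h.1.eq_or_lt with rfl | hlt
  · simp [extendDriver]
  · simp [extendDriver, not_le.2 hlt, h.2]

theorem extendDriver_of_mem_right {t : ℝ} (hae : a < e) (h : t ∈ Icc e T) :
    extendDriver lam a b e T c t =
      lam a + b * (e - a) + c * √(T - e) - c * √(T - t) := by
  rcases h.1.eq_or_lt with rfl | hlt
  · simp [extendDriver, not_le.2 hae]
  · simp [extendDriver, not_le.2 hlt, not_le.2 (hae.trans hlt)]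

theorem abs_add_le_max_of_mul_nonpos {x y : ℝ} (h : x * y ≤ 0) : |x + y| ≤ max |x| |y| := by
  rcases le_total 0 x with hx | hx <;> rcases le_total 0 y with hy | hy <;>
    rcases le_total 0 (x + y) with hxy | hxy <;>
    simp only [abs_of_nonneg, abs_of_nonpos, hx, hy, hxy, le_max_iff] <;>
    by_contra! hcon <;> nlinarith [hcon.1, hcon.2]

theorem sqrt_sub_sqrt_mem {r s : ℝ} (hrs : r ≤ s) (hsT : s ≤ T) :
    0 ≤ √(T - r) - √(T - s) ∧ √(T - r) - √(T - s) ≤ √(s - r) := by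
  have h1 : √(T - s) ≤ √(T - r) := Real.sqrt_le_sqrt (by linarith)
  refine ⟨by linarith, ?_⟩
  have h2 : √(T - r) ≤ √(T - s) + √(s - r) := by
    refine Real.sqrt_le_iff.2 ⟨by positivity, ?_⟩
    have e1 := Real.sq_sqrt (by linarith : 0 ≤ T - s)
    have e2 := Real.sq_sqrt (by linarith : 0 ≤ s - r)
    nlinarith [Real.sqrt_nonneg (T - s), Real.sqrt_nonneg (s - r)]
  linarith

theorem mul_le_mul_sqrt_of_le {x L K : ℝ} (hx : 0 ≤ x) (hxL : x ≤ L) (hK : |b| * √L ≤ K) :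
    |b| * x ≤ K * √x := by
  have h1 : |b| * √x ≤ K := (by gcongr : |b| * √x ≤ |b| * √L).trans hK
  calc |b| * x = |b| * √x * √x := by rw [mul_assoc, Real.mul_self_sqrt hx]
    _ ≤ K * √x := by gcongr

theorem extendDriver_holder {C K C' : ℝ} (hae : a < e) (heT : e ≤ T) (hC : 0 ≤ C)
    (hlam : ∀ r ∈ Icc 0 a, ∀ s ∈ Icc 0 a, r ≤ s → |lam s - lam r| ≤ C * √(s - r))
    (hbc : b * c ≤ 0) (hK : |b| * √(e - a) ≤ K) (hCK : C + K ≤ C') (hc : |c| ≤ C')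
    (hlong : 4 * a * (T - e) ≤ (e - a) ^ 2) :
    ∀ r ∈ Icc 0 T, ∀ s ∈ Icc 0 T, r ≤ s →
      |extendDriver lam a b e T c s - extendDriver lam a b e T c r| ≤ C' * √(s - r) := by
  intro r hr s hs hrs
  have hK0 : 0 ≤ K := le_trans (by positivity) hK
  have hKC' : K ≤ C' := by linarith
  have hCC' : C ≤ C' := by linarith
  have hC'0 : 0 ≤ C' := by linarith
  have mono : ∀ {x y k : ℝ}, x ≤ y → k ≤ C' → k * √x ≤ C' * √y := fun hxy hk =>
    mul_le_mul hk (Real.sqrt_le_sqrt hxy) (Real.sqrt_nonneg _) hC'0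
  have cap : ∀ t ∈ Icc e T, |c * (√(T - e) - √(T - t))| ≤ |c| * √(t - e) := fun t ht => by
    have := sqrt_sub_sqrt_mem ht.1 ht.2
    rw [abs_mul, abs_of_nonneg this.1]
    gcongr
    exact this.2
  have opp : ∀ x t : ℝ, 0 ≤ x → t ∈ Icc e T → |b * x + c * (√(T - e) - √(T - t))| ≤
      max (|b| * x) (|c| * √(t - e)) := fun x t hx ht => by
    have h1 := (sqrt_sub_sqrt_mem ht.1 ht.2).1
    refine (abs_add_le_max_of_mul_nonpos ?_).trans (max_le_max ?_ (cap t ht))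
    · have : b * x * (c * (√(T - e) - √(T - t))) = b * c * (x * (√(T - e) - √(T - t))) := by ring
      rw [this]
      exact mul_nonpos_of_nonpos_of_nonneg hbc (mul_nonneg hx h1)
    · rw [abs_mul, abs_of_nonneg hx]
  rcases le_total s a with hsa | hsa
  · rw [extendDriver_of_le hsa, extendDriver_of_le (hrs.trans hsa)]
    exact (hlam r ⟨hr.1, hrs.trans hsa⟩ s ⟨hs.1, hsa⟩ hrs).trans (mono le_rfl hCC')
  rcases le_total s e with hse | hse
  · rw [extendDriver_of_mem_left ⟨hsa, hse⟩]
    rcases le_total r a with hra | hra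
    · rw [extendDriver_of_le hra]
      have h1 := hlam r ⟨hr.1, hra⟩ a ⟨hr.1.trans hra, le_rfl⟩ hra
      have h2 := mul_le_mul_sqrt_of_le (b := b) (sub_nonneg.2 hsa) (by linarith) hK
      have h3 : lam a + b * (s - a) - lam r = b * (s - a) + (lam a - lam r) := by ring
      rw [h3]
      refine (abs_add_le _ _).trans ?_
      rw [abs_mul, abs_of_nonneg (sub_nonneg.2 hsa)]
      calc |b| * (s - a) + |lam a - lam r| ≤ K * √(s - a) + C * √(a - r) := add_le_add h2 h1
        _ ≤ K * √(s - r) + C * √(s - r) := by gcongr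
        _ = (C + K) * √(s - r) := by ring
        _ ≤ C' * √(s - r) := by gcongr
    · rw [extendDriver_of_mem_left ⟨hra, hrs.trans hse⟩]
      have h3 : lam a + b * (s - a) - (lam a + b * (r - a)) = b * (s - r) := by ring
      rw [h3, abs_mul, abs_of_nonneg (sub_nonneg.2 hrs)]
      exact (mul_le_mul_sqrt_of_le (sub_nonneg.2 hrs) (by linarith) hK).trans (mono le_rfl hKC')
  rw [extendDriver_of_mem_right hae ⟨hse, hs.2⟩]
  rcases le_total r a with hra | hra
  · rw [extendDriver_of_le hra]
    have h1 := hlam r ⟨hr.1, hra⟩ a ⟨hr.1.trans hra, le_rfl⟩ hra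
    have h2 := opp (e - a) s (by linarith) ⟨hse, hs.2⟩
    have h3 : lam a + b * (e - a) + c * √(T - e) - c * √(T - s) - lam r =
      (b * (e - a) + c * (√(T - e) - √(T - s))) + (lam a - lam r) := by ring
    rw [h3]
    refine (abs_add_le _ _).trans ((add_le_add h2 h1).trans ?_)
    rw [max_add]
    refine max_le ?_ ?_
    · calc |b| * (e - a) + C * √(a - r) ≤ K * √(e - a) + C * √(a - r) :=
          add_le_add (mul_le_mul_sqrt_of_le (by linarith) le_rfl hK) le_rfl
        _ ≤ K * √(s - r) + C * √(s - r) := by gcongr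
        _ = (C + K) * √(s - r) := by ring
        _ ≤ C' * √(s - r) := by gcongr
    · have e1 := Real.sq_sqrt (by linarith : 0 ≤ s - e)
      have e2 := Real.sq_sqrt (by linarith : 0 ≤ a - r)
      have h4 : √(s - e) + √(a - r) ≤ √(s - r) := by
        refine Real.le_sqrt_of_sq_le ?_
        have h5 : 2 * (√(s - e) * √(a - r)) ≤ e - a := by
          refine le_of_sq_le_sq ?_ (by linarith)
          have h6 : (s - e) * (a - r) ≤ (T - e) * a :=
            mul_le_mul (by linarith [hs.2]) (by linarith [hr.1]) (by linarith) (by linarith)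
          calc (2 * (√(s - e) * √(a - r))) ^ 2 = 4 * (√(s - e) ^ 2 * √(a - r) ^ 2) := by ring
            _ ≤ (e - a) ^ 2 := by rw [e1, e2]; linarith
        nlinarith
      calc |c| * √(s - e) + C * √(a - r) ≤ C' * √(s - e) + C' * √(a - r) := by gcongr
        _ = C' * (√(s - e) + √(a - r)) := by ring
        _ ≤ C' * √(s - r) := by gcongr
  rcases le_total r e with hre | hre
  · rw [extendDriver_of_mem_left ⟨hra, hre⟩]
    have h3 : lam a + b * (e - a) + c * √(T - e) - c * √(T - s) - (lam a + b * (r - a)) =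
      b * (e - r) + c * (√(T - e) - √(T - s)) := by ring
    rw [h3]
    refine (opp (e - r) s (by linarith) ⟨hse, hs.2⟩).trans (max_le ?_ (mono (by linarith) hc))
    exact (mul_le_mul_sqrt_of_le (by linarith) (by linarith) hK).trans (mono (by linarith) hKC')
  · rw [extendDriver_of_mem_right hae ⟨hre, hrs.trans hs.2⟩]
    have h3 : lam a + b * (e - a) + c * √(T - e) - c * √(T - s) -
      (lam a + b * (e - a) + c * √(T - e) - c * √(T - r)) = c * (√(T - r) - √(T - s)) := by ring
    have h4 := sqrt_sub_sqrt_mem hrs hs.2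
    rw [h3, abs_mul, abs_of_nonneg h4.1]
    exact (mul_le_mul_of_nonneg_left h4.2 (abs_nonneg _)).trans (mono le_rfl hc)

theorem localLeft_linear {mu : ℝ → ℝ} {x₀ s : ℝ} (ha : 0 ≤ a) (has : a < s)
    (hl : ∀ t ∈ Icc a s, mu t = x₀ + b * (t - a)) : LocalLeft mu s := by
  refine localLeft_of_bounded_deriv (lam' := fun _ => b) (L := |b|) ha has (fun t ht => ?_)
    fun _ _ => le_rfl
  have h1 : HasDerivWithinAt (fun t => x₀ + b * (t - a)) b (Icc a s) t := by
    simpa using ((((hasDerivAt_id t).sub_const a).const_mul b).const_add x₀).hasDerivWithinAt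
  exact h1.congr_of_mem hl ht

theorem localLeft_sqrt_interior {mu : ℝ → ℝ} {x₀ s : ℝ} (he : 0 ≤ e) (hes : e < s) (hsT : s < T)
    (hl : ∀ t ∈ Icc e T, mu t = x₀ - c * √(T - t)) : LocalLeft mu s := by
  refine localLeft_of_bounded_deriv (lam' := fun t => -(c * -(1 / (2 * √(T - t)))))
    (L := |c| * (1 / (2 * √(T - s)))) he hes (fun t ht => ?_) fun t ht => ?_
  · have h1 := ((hasDerivWithinAt_sqrt_sub (by linarith [ht.2] : t < T) (Icc e s)).const_mul
      c).const_sub x₀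
    exact h1.congr_of_mem (fun r hr => hl r ⟨hr.1, hr.2.trans hsT.le⟩) ht
  · have hp : 0 < √(T - s) := Real.sqrt_pos.2 (by linarith)
    have hle : √(T - s) ≤ √(T - t) := Real.sqrt_le_sqrt (by linarith [ht.2])
    rw [abs_neg, abs_mul, abs_neg, abs_of_nonneg (by positivity : 0 ≤ 1 / (2 * √(T - t)))]
    gcongr

end extend

/-! ### Visiting one more point -/

/-- The state of the construction at time `t`: the driving function on `[0, t]` is controlled and
generates a trace, and the points with index at least `n` are still alive. -/
structure Stage (z : ℕ → ℂ) (n : ℕ) (t : ℝ) (lam : ℝ → ℝ) : Prop where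
  nonneg : 0 ≤ t
  holder : ∃ C, 0 ≤ C ∧ C < 4 ∧ ∀ r ∈ Icc 0 t, ∀ s ∈ Icc 0 t, r ≤ s →
    |lam s - lam r| ≤ C * √(s - r)
  localLeft : ∀ s ∈ Ioc 0 t, LocalLeft lam s
  alive : ∀ m ≥ n, Alive lam 0 t (z m)

theorem exists_mem_Ioo_notMem_of_countable {x y : ℝ} (hxy : x < y) {S : Set ℝ}
    (hS : S.Countable) : ∃ t ∈ Ioo x y, t ∉ S := by
  obtain ⟨t, ht, h⟩ := (hS.dense_compl ℝ).exists_mem_open isOpen_Ioo (nonempty_Ioo.2 hxy)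
  exact ⟨t, h, ht⟩

/-- For all but countably many slopes of a given sign, a linear driving function does not capture
any of countably many given points. -/
theorem countable_slopes (x₀ a σ : ℝ) (hσ : σ ≠ 0) (w : ℕ → ℂ) (n : ℕ)
    (hw : ∀ m ≥ n, 0 < (w m).im) :
    {β : ℝ | 0 < β ∧ ∃ m ≥ n, ∃ T g,
      Captured (fun t => x₀ + σ * β * (t - a)) a (w m) T g}.Countable := by
  have h : {β : ℝ | 0 < β ∧ ∃ m ≥ n, ∃ T g,
      Captured (fun t => x₀ + σ * β * (t - a)) a (w m) T g} =
      ⋃ m, {β : ℝ | 0 < β ∧ n ≤ m ∧ ∃ T g,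
        Captured (fun t => x₀ + σ * β * (t - a)) a (w m) T g} := by
    ext β; simp only [mem_ofPred_eq, mem_iUnion]
    exact ⟨fun ⟨h0, m, hm, h⟩ => ⟨m, h0, hm, h⟩, fun ⟨m, h0, hm, h⟩ => ⟨h0, m, hm, h⟩⟩
  rw [h]
  refine countable_iUnion fun m => Set.Subsingleton.countable ?_
  rintro β₁ ⟨p1, hm, T₁, g₁, h₁⟩ β₂ ⟨p2, -, T₂, g₂, h₂⟩
  have hs : 0 < σ * β₁ * (σ * β₂) := by
    have := mul_self_pos.2 hσ
    have e : σ * β₁ * (σ * β₂) = σ * σ * (β₁ * β₂) := by ring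
    rw [e]; positivity
  have := eq_of_slope_equation (hw m hm) hs
    (h₁.linear_slope (fun _ _ => rfl) (mul_ne_zero hσ p1.ne') (hw m hm))
    (h₂.linear_slope (fun _ _ => rfl) (mul_ne_zero hσ p2.ne') (hw m hm))
  exact mul_left_cancel₀ hσ this

theorem Stage.exists_succ {z : ℕ → ℂ} {n : ℕ} {a : ℝ} {lam : ℝ → ℝ}
    (hinj : Function.Injective z) (hst : Stage z n a lam) :
    ∃ T lam', a + 1 ≤ T ∧ EqOn lam' lam (Icc 0 a) ∧ Stage z (n + 1) T lam' ∧
      ∃ g, Captured lam' 0 (z n) T g := by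
  obtain ⟨ha, ⟨C, hC0, hC4, hhol⟩, hloc, halive⟩ := hst
  choose! G hG hG0 using halive
  have haa : a ∈ Icc 0 a := right_mem_Icc.2 ha
  have hw : ∀ m ≥ n, 0 < (G m a).im := fun m hm => (hG m hm).im_pos a haa
  set x₀ := lam a with hx₀
  set N := ‖G n a - x₀‖ ^ 2 with hN
  have hN0 : 0 ≤ N := by positivity
  set T₀ := 1 + a * (N + 7) with hT₀
  have hT₀1 : 1 ≤ T₀ := by
    have : 0 ≤ a * (N + 7) := by positivity
    linarith
  set R := √(N + 7 * (T₀ + 1)) with hR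
  have hR2 : R ^ 2 = N + 7 * (T₀ + 1) := Real.sq_sqrt (by linarith)
  have hR0 : 0 < R := Real.sqrt_pos.2 (by linarith)
  have hS0 : 0 < √(T₀ + 1) := Real.sqrt_pos.2 (by linarith)
  obtain ⟨σ, hσ, hσX⟩ : ∃ σ : ℝ, |σ| = 1 ∧ σ * (G n a - x₀).re ≤ 0 := by
    rcases le_total (G n a - x₀).re 0 with h | h
    · exact ⟨1, by simp, by linarith⟩
    · exact ⟨-1, by simp, by linarith⟩
  have hσ0 : σ ≠ 0 := fun h => by simp [h] at hσ
  obtain ⟨β, hβ, hβS⟩ := exists_mem_Ioo_notMem_of_countable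
    (lt_min (by have : 0 < 4 - C := by linarith
                positivity) (by positivity) :
      0 < min ((4 - C) / (2 * √(T₀ + 1))) (1 / R)) (countable_slopes x₀ a σ hσ0 _ n hw)
  set b := σ * β with hb
  have hβ0 := hβ.1
  have hbabs : |b| = β := by rw [hb, abs_mul, hσ, one_mul, abs_of_pos hβ0]
  have hb0 : b ≠ 0 := mul_ne_zero hσ0 hβ0.ne'
  have hbT : |b| * √(T₀ + 1) ≤ (4 - C) / 2 := by
    have := hβ.2.le.trans (min_le_left _ _)
    rw [le_div_iff₀ (by positivity)] at this
    rw [hbabs]; linarith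
  have hbR : |b| * R ≤ 1 := by
    have := hβ.2.le.trans (min_le_right _ _)
    rw [le_div_iff₀ hR0] at this
    rw [hbabs]; exact this
  set ℓ : ℝ → ℝ := fun t => x₀ + b * (t - a) with hℓ
  have hℓa : ℓ a = x₀ := by simp [hℓ]
  have hwait : ∀ m ≥ n, Alive ℓ a (a + (T₀ + 1)) (G m a) := fun m hm => by
    rcases alive_or_captured (lam := ℓ) (a := a) (b := a + (T₀ + 1)) (by fun_prop) (by linarith)
      (hw m hm) with h | ⟨T, -, g, hg⟩
    · exact h
    · exact absurd ⟨hβ0, m, hm, T, g, hg⟩ hβS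
  choose! H hH hHa using hwait
  have hHn := hH n le_rfl
  have hbX : b * (H n a - ℓ a).re ≤ 0 := by
    rw [hHa n le_rfl, hℓa, hb, mul_comm σ, mul_assoc]
    exact mul_nonpos_of_nonneg_of_nonpos hβ0.le hσX
  have hne : ∀ m > n, H m a ≠ H n a := fun m hm h => by
    rw [hHa m hm.le, hHa n le_rfl] at h
    have := (hG m hm.le).eqOn (hG n le_rfl) haa h (left_mem_Icc.2 ha)
    rw [hG0 m hm.le, hG0 n le_rfl] at this
    exact hm.ne' (hinj this)
  obtain ⟨e, he, heS⟩ := exists_mem_Ioo_notMem_of_countable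
    (by linarith : a + T₀ < a + (T₀ + 1))
    (countable_iUnion fun m => countable_iUnion fun hm : m > n =>
      (hH m hm.le).countable_phase_eq_one (fun _ _ => rfl) hb0 hHn hbX (hne m hm))
  have hae : a < e := by linarith [he.1]
  have hemem : e ∈ Icc a (a + (T₀ + 1)) := ⟨hae.le, he.2.le⟩
  set Z := H n e - ℓ e with hZ
  have hZim : 0 < Z.im := by
    rw [hZ, sub_ofReal_im]; exact hHn.im_pos e hemem
  have hZ0 : 0 < ‖Z‖ := norm_pos_iff.2 fun h => by rw [h] at hZim; exact lt_irrefl _ hZim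
  set τ := (‖Z‖ / 2) ^ 2 with hτ
  have hτ0 : 0 < τ := by positivity
  have hsqrt : √τ = ‖Z‖ / 2 := Real.sqrt_sq (by positivity)
  set u : ℂ := Z * ((2 / ‖Z‖ : ℝ) : ℂ) with hu
  have hu2 : ‖u‖ = 2 := by
    rw [hu, norm_mul, Complex.norm_real, Real.norm_of_nonneg (by positivity)]
    field_simp
  have hure : u.re = Z.re * (2 / ‖Z‖) := Complex.re_mul_ofReal _ _
  have huim : u.im = Z.im * (2 / ‖Z‖) := Complex.im_mul_ofReal _ _
  have huim0 : 0 < u.im := by rw [huim]; positivity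
  have hκ : u.re / u.im = Z.re / Z.im := by
    rw [hure, huim]; field_simp
  set c := 2 * u.re with hc
  have hc4 : |c| < 4 := by
    rw [hc, abs_mul, abs_two]
    have : |u.re| < ‖u‖ := Complex.abs_re_lt_norm.2 huim0.ne'
    linarith
  set T := e + τ with hT
  have heT : e < T := by linarith
  set mu := extendDriver lam a b e T c with hmu
  have hmu1 : EqOn mu lam (Icc 0 a) := fun t ht => extendDriver_of_le ht.2
  have hmu2 : EqOn mu ℓ (Icc a e) := fun t ht => extendDriver_of_mem_left ht
  set x₁ := lam a + b * (e - a) + c * √(T - e) with hx₁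
  have hmu3 : ∀ t ∈ Icc e T, mu t = x₁ - 2 * u.re * √(T - t) :=
    fun t ht => extendDriver_of_mem_right hae ht
  have hmue : mu e = ℓ e := hmu2 (right_mem_Icc.2 hae.le)
  have hq : sqrtFlow x₁ u T e = H n e := by
    have h1 := sqrtFlow_sub_driver (hmu3 e (left_mem_Icc.2 heT.le))
    rw [hmue, hT, add_sub_cancel_left, hsqrt, hu, mul_assoc, ← Complex.ofReal_mul,
      show 2 / ‖Z‖ * (‖Z‖ / 2) = 1 by field_simp, Complex.ofReal_one, mul_one, hZ] at h1
    exact sub_left_injective h1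
  have hflow : ∀ m ≥ n, ∃ g, Flow mu 0 e g ∧ g 0 = z m ∧ g e = H m e := fun m hm => by
    have h1 := (hG m hm).congr_driver hmu1
    have h2 := ((hH m hm).mono le_rfl hemem.2).congr_driver hmu2
    refine ⟨_, h1.glue h2 (hHa m hm).symm ha hae.le, by simp [ha, hG0 m hm], by simp [not_le.2 hae]⟩
  have hnorm : ‖Z‖ ^ 2 ≤ N + 7 * (e - a) := by
    have h0 : ‖H n a - ℓ a‖ ^ 2 = N := by rw [hHa n le_rfl, hℓa]
    have h1 : ‖H n a - ℓ a‖ ^ 2 + 7 * (a + (T₀ + 1) - a) ≤ R ^ 2 := by rw [hR2, h0]; linarith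
    have h2 : ‖H n e - ℓ e‖ ^ 2 ≤ ‖H n a - ℓ a‖ ^ 2 + 7 * (e - a) :=
      hHn.norm_sub_sq_le_linear (fun _ _ => rfl) hR0.le hbR h1 e hemem
    rwa [h0] at h2
  refine ⟨T, mu, by linarith [he.1], hmu1, ⟨by linarith, ?_, ?_, ?_⟩, ?_⟩
  · refine ⟨max ((4 + C) / 2) |c|, le_max_of_le_left (by linarith), max_lt (by linarith) hc4,
      extendDriver_holder hae heT.le hC0 hhol ?_ (K := (4 - C) / 2) ?_ ?_ (le_max_right _ _) ?_⟩
    · have h1 := hHn.mul_re_nonpos (fun _ _ => rfl) hb0 hbX e hemem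
      have h2 : b * c = b * Z.re * (4 / ‖Z‖) := by rw [hc, hure]; ring
      rw [h2]
      exact mul_nonpos_of_nonpos_of_nonneg h1 (by positivity)
    · refine le_trans ?_ hbT
      gcongr
      linarith [he.2]
    · refine le_trans (le_of_eq ?_) (le_max_left _ _)
      ring
    · have hE : T₀ ≤ e - a := by linarith [he.1]
      have h1 : 4 * a * (T - e) = a * ‖Z‖ ^ 2 := by rw [hT, hτ]; ring
      rw [h1]
      calc a * ‖Z‖ ^ 2 ≤ a * (N + 7 * (e - a)) := by gcongr
        _ ≤ a * ((N + 7) * (e - a)) := by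
            gcongr
            nlinarith
        _ = a * (N + 7) * (e - a) := by ring
        _ ≤ (e - a) * (e - a) := by
            gcongr
            linarith
        _ = (e - a) ^ 2 := by ring
  · intro s hs
    rcases le_or_gt s a with hsa | hsa
    · exact (hloc s ⟨hs.1, hsa⟩).congr (hmu1.mono (Icc_subset_Icc_right hsa))
    rcases le_or_gt s e with hse | hse
    · exact localLeft_linear (b := b) (x₀ := x₀) ha hsa fun t ht => hmu2 ⟨ht.1, ht.2.trans hse⟩
    rcases hs.2.lt_or_eq with hsT | rfl
    · exact localLeft_sqrt_interior (by linarith) hse hsT hmu3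
    · exact localLeft_sqrt (by linarith) heT hmu3 huim0 hu2
  · intro m hm
    have hm' : m > n := hm
    obtain ⟨g, hg, hg0, hge⟩ := hflow m hm'.le
    rw [← hg0]
    refine hg.alive_glue (by linarith) heT.le ?_
    rw [hge]
    have hmne : H m e ≠ H n e := fun h =>
      hne m hm' ((hH m hm'.le).eqOn hHn hemem h (left_mem_Icc.2 (by linarith)))
    rcases alive_or_captured (continuousOn_of_sqrt hmu3) heT.le
      ((hH m hm'.le).im_pos e hemem) with h | ⟨T', hT', g', hg'⟩
    · exact h
    · refine absurd ?_ heS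
      simp only [mem_iUnion]
      refine ⟨m, hm', ⟨hae, he.2⟩, ?_⟩
      have := phase_eq_one_of_captured hmu3 huim0 hu2 hg' hT'.2 (by rwa [hq])
      rwa [hq, hκ] at this
  · obtain ⟨g, hg, hg0, hge⟩ := hflow n le_rfl
    have h1 := captured_sqrtFlow hmu3 heT huim0 hu2
    rw [hq, ← hge] at h1
    have := hg.captured_glue (by linarith) h1
    rwa [hg0] at this


/-! ### Visiting all points -/

theorem Stage.zero {z : ℕ → ℂ} (hz : ∀ n, 0 < (z n).im) : Stage z 0 0 fun _ => 0 where
  nonneg := le_rfl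
  holder := ⟨0, le_rfl, by norm_num, by simp⟩
  localLeft s hs := absurd hs.1 (not_lt.2 hs.2)
  alive m _ := Alive.self _ (hz m)

theorem holderWith_half {lam : ℝ → ℝ} {C : ℝ≥0}
    (h : ∀ r, 0 ≤ r → ∀ s, r ≤ s → |lam s - lam r| ≤ C * √(s - r)) :
    HolderWith C (1 / 2) fun t : ℝ≥0 => lam t := by
  have key : ∀ x y : ℝ≥0, |lam x - lam y| ≤ C * |(x : ℝ) - y| ^ (1 / 2 : ℝ) := by
    intro x y
    rw [← Real.sqrt_eq_rpow]
    rcases le_total (x : ℝ) y with hxy | hxy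
    · rw [abs_sub_comm, abs_sub_comm (x : ℝ), abs_of_nonneg (sub_nonneg.2 hxy)]
      exact h x x.2 y hxy
    · rw [abs_of_nonneg (sub_nonneg.2 hxy)]
      exact h y y.2 x hxy
  intro x y
  have hC : (C : ℝ≥0∞) = ENNReal.ofReal C := (ENNReal.ofReal_coe_nnreal).symm
  rw [edist_dist, edist_dist, ENNReal.ofReal_rpow_of_nonneg dist_nonneg (by positivity), hC,
    ← ENNReal.ofReal_mul C.coe_nonneg]
  refine ENNReal.ofReal_le_ofReal ?_
  simpa [Real.dist_eq, NNReal.dist_eq] using key x y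

/-- The stages of the construction, each extending the previous one, are stages of a single
driving function. -/
theorem exists_driver {z : ℕ → ℂ} (hz : ∀ n, 0 < (z n).im) (hinj : Function.Injective z) :
    ∃ (lam : ℝ → ℝ) (t : ℕ → ℝ), (∀ n, t n + 1 ≤ t (n + 1)) ∧
      (∀ n, ∃ lam', EqOn lam lam' (Icc 0 (t n)) ∧ Stage z n (t n) lam') ∧
      ∀ n, ∃ g, Captured lam 0 (z n) (t (n + 1)) g := by
  let S (n : ℕ) := {p : ℝ × (ℝ → ℝ) // Stage z n p.1 p.2}
  have hstep : ∀ n (p : S n), ∃ q : S (n + 1), p.1.1 + 1 ≤ q.1.1 ∧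
      EqOn q.1.2 p.1.2 (Icc 0 p.1.1) ∧ ∃ g, Captured q.1.2 0 (z n) q.1.1 g := fun n p => by
    obtain ⟨T, lam', h1, h2, h3, h4⟩ := p.2.exists_succ hinj
    exact ⟨⟨(T, lam'), h3⟩, h1, h2, h4⟩
  choose next hnext using hstep
  let p : ∀ n, S n := fun n => Nat.rec ⟨(0, fun _ => 0), Stage.zero hz⟩ next n
  have hp : ∀ n, p (n + 1) = next n (p n) := fun n => rfl
  let t : ℕ → ℝ := fun n => (p n).1.1
  let l : ℕ → ℝ → ℝ := fun n => (p n).1.2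
  have ht : ∀ n, t n + 1 ≤ t (n + 1) := fun n => (hnext n (p n)).1
  have hmono : Monotone t := monotone_nat_of_le_succ fun n => by linarith [ht n]
  have hnt : ∀ n : ℕ, (n : ℝ) ≤ t n := fun n => by
    induction n with
    | zero => exact (p 0).2.nonneg.trans_eq' (by simp)
    | succ n ih => push_cast; linarith [ht n]
  have hl : ∀ m n, m ≤ n → EqOn (l n) (l m) (Icc 0 (t m)) := fun m n hmn => by
    induction n, hmn using Nat.le_induction with
    | base => exact fun _ _ => rfl
    | succ n hmn ih =>
      exact fun s hs => ((hnext n (p n)).2.1 ⟨hs.1, hs.2.trans (hmono hmn)⟩).trans (ih hs)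
  have hlam : ∀ n, EqOn (fun s => l ⌈s⌉₊ s) (l n) (Icc 0 (t n)) := fun n s hs => by
    rcases le_total n ⌈s⌉₊ with h | h
    · exact hl _ _ h hs
    · exact (hl _ _ h ⟨hs.1, (Nat.le_ceil s).trans (hnt _)⟩).symm
  refine ⟨fun s => l ⌈s⌉₊ s, t, ht, fun n => ⟨l n, hlam n, (p n).2⟩, fun n => ?_⟩
  obtain ⟨g, hg⟩ := (hnext n (p n)).2.2
  exact ⟨g, hg.congr_driver (hlam (n + 1))⟩

end Loewner

/-- For every sequence of distinct points `z 0, z 1, …` of the upper half-plane there is a Loewner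
trace, driven by a function of Lip(1/2) norm at most 4, which visits these points in this order:
the first visit to `z n` takes place at time `t n`, and `t 0 < t 1 < t 2 < …`. -/
theorem proposition1p2 (z : ℕ → UpperHalfPlane) (hz : Function.Injective z) :
    ∃ (lam : ℝ → ℝ) (γ : ℝ → ℂ), Loewner.lipHalfNorm lam ≤ 4 ∧ Loewner.IsTrace lam γ ∧
      ∃ t : ℕ → ℝ, StrictMono t ∧
        ∀ n, IsLeast {s : ℝ | 0 ≤ s ∧ γ s = (z n : ℂ)} (t n) := by
  obtain ⟨lam, t, ht, hstage, hcap⟩ := Loewner.exists_driver (z := fun n => (z n : ℂ))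
    (fun n => (z n).im_pos) (fun m n h => hz (UpperHalfPlane.ext h))
  have hnt : ∀ n : ℕ, (n : ℝ) ≤ t n := fun n => by
    induction n with
    | zero =>
      obtain ⟨_, -, h⟩ := hstage 0
      exact h.nonneg.trans_eq' (by simp)
    | succ n ih => push_cast; linarith [ht n]
  have hholder : ∀ r, 0 ≤ r → ∀ s, r ≤ s → |lam s - lam r| ≤ (4 : ℝ≥0) * √(s - r) := by
    intro r hr s hrs
    obtain ⟨lam', hl, hst⟩ := hstage ⌈s⌉₊
    obtain ⟨C, -, hC, h⟩ := hst.holder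
    have hs : s ≤ t ⌈s⌉₊ := (Nat.le_ceil s).trans (hnt _)
    have hr' : r ∈ Set.Icc 0 (t ⌈s⌉₊) := ⟨hr, hrs.trans hs⟩
    have hs' : s ∈ Set.Icc 0 (t ⌈s⌉₊) := ⟨hr.trans hrs, hs⟩
    rw [hl hs', hl hr']
    exact (h r hr' s hs' hrs).trans (mul_le_mul_of_nonneg_right hC.le (Real.sqrt_nonneg _))
  have hH := Loewner.holderWith_half hholder
  have hcont : ContinuousOn lam (Set.Ici 0) := by
    rw [continuousOn_iff_continuous_domRestrict]
    exact (hH.continuous (by norm_num)).comp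
      (continuous_subtype_val.subtype_mk fun x : Set.Ici (0 : ℝ) => x.2)
  have hloc : ∀ T, 0 < T → Loewner.LocalLeft lam T := fun T hT => by
    obtain ⟨lam', hl, hst⟩ := hstage ⌈T⌉₊
    have hT' : T ≤ t ⌈T⌉₊ := (Nat.le_ceil T).trans (hnt _)
    exact (hst.localLeft T ⟨hT, hT'⟩).congr (hl.mono (Set.Icc_subset_Icc_right hT'))
  obtain ⟨γ, hγ, htip⟩ := Loewner.exists_isTrace hcont hloc
  refine ⟨lam, γ, hH.eHolderNorm_le, hγ, fun n => t (n + 1),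
    strictMono_nat_of_lt_succ fun n => by linarith [ht (n + 1)], fun n => ?_⟩
  obtain ⟨g, hg⟩ := hcap n
  refine ⟨⟨hg.lt.le, (hg.eq_tip (htip _ hg.lt.le)).symm⟩, fun s ⟨hs, hsz⟩ => ?_⟩
  by_contra! hlt
  exact (htip s hs).not_alive hcont hs ⟨g, hg.flow s hlt, hg.initial.trans hsz.symm⟩
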